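/- Let $(\mu_t)_{t\in[0,1]}$ be Borel probability measures on $\mathbb R$ with finite first moments, $F(t,\cdot)$ the distribution function of $\mu_t$, $\ell_t=\inf\operatorname{supp}\mu_t\in[-\infty,\infty)$, $r_t=\sup\operatorname{supp}\mu_t\in(-\infty,\infty]$, and $E=\{(t,x):t\in[0,1],\ \ell_t<x<r_t\}$. Time derivatives at $t=0,1$ are one-sided. For a measure $\eta$ put $C_\eta(k)=\int (x-k)^+\,\eta(dx)$, and for $t\in[0,1)$, $\epsilon\in(0,1-t]$ let $$x_1^\epsilon(t)=\inf\Big\{x\in\mathbb R:\ \sup_{k\in\mathbb R}\big(C_{\mu_t|_{[x,\infty)}}(k)-C_{\mu_{t+\epsilon}}(k)\big)=0\Big\}\in[-\infty,\infty],\qquad \inf\emptyset=r_t,$$ the point at which the decreasing supermartingale coupling of $\mu_t$ and $\mu_{t+\epsilon}$ passes from martingale transport (on its right) to supermartingale transport. Assume: 1. (i) $\int\varphi\,d\mu_s\le\int\varphi\,d\mu_t$ for all $s\le t$ and all convex non-increasing $\varphi$, and $t\mapsto\mu_t$ is weakly continuous. (ii) $F\in C^4_b(E)$ (continuous bounded derivatives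 up to order $4$), and each $\mu_t$ has a density $f(t,\cdot)=\partial_xF(t,\cdot)$, positive on $(\ell_t,r_t)$. (iii) There is $\epsilon_1\in(0,1]$ such that for all $t\in[0,1)$ and $0<\epsilon\le\epsilon_1\wedge(1-t)$ there are $m_\epsilon(t)<m^\epsilon(t)$ with $\ell_{t+\epsilon}\le\ell_t\le m_\epsilon(t)<m^\epsilon(t)\le r_t\le r_{t+\epsilon}$, $\ell_{t+\epsilon}<\ell_t\vee m_\epsilon(t)$, $m^\epsilon(t)\wedge r_t<r_{t+\epsilon}$, such that $f(t+\epsilon,\cdot)<f(t,\cdot)$ on $(m_\epsilon(t),m^\epsilon(t))$, $f(t+\epsilon,\cdot)>f(t,\cdot)$ on $(\ell_{t+\epsilon},m_\epsilon(t))\cup(m^\epsilon(t),r_{t+\epsilon})$, and $f(t+\epsilon,\cdot)=f(t,\cdot)$ at those of the points $m_\epsilon(t),m^\epsilon(t)$ that lie in $(\ell_t,r_t)$. 2. For each $t\in[0,1]$ the function $\partial_tF(t,\cdot)$ on $(\ell_t,r_t)$ has exactly one local minimizer $m_t$, and there is a real $\tilde m_t\in[\ell_t,r_t)$ such that $\partial_tF(t,\cdot)$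 has $\tilde m_t$ as its only local maximizer if $\tilde m_t>\ell_t$, and none if $\tilde m_t=\ell_t$. With $m^0(t)=m_t$ and some $\epsilon_2>0$, $\epsilon_0=\epsilon_1\wedge\epsilon_2$, the map $(t,\epsilon)\mapsto m^\epsilon(t)$ is continuous on $\{0\le\epsilon\le\epsilon_0,\ 0\le t\le1-\epsilon\}$. 3. (i) $(t,\epsilon)\mapsto x_1^\epsilon(t)$ is bounded (in particular real-valued) and uniformly continuous on $\{0<\epsilon\le\epsilon_0,\ 0\le t\le1-\epsilon\}$. (ii) $r_t=r\in(-\infty,\infty]$ for all $t\in[0,1]$. 4. $\lim_{K\to\infty}\sup_{t\in[0,1]}\int_K^\infty|\xi\,\partial_tf(t,\xi)|\,d\xi=0$ (automatic if $r<\infty$). Then there is a continuous function $x_1:[0,1]\to\mathbb R$ with $x_1(t)=\lim_{\epsilon\downarrow0}x_1^\epsilon(t)$ for all $t\in[0,1)$. Moreover, for every $t\in[0,1]$, $\ell_t\le x_1(t)<r$, for every real $x\in[\ell_t,r)$ the function $\xi\mapsto(x-\xi)\partial_tf(t,\xi)$ is integrable on $(x,\infty)$, and $x=x_1(t)$ is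 the only real $x\in[\ell_t,r)$ with $$\int_x^{\infty}(x-\xi)\,\partial_tf(t,\xi)\,d\xi=0 .$$ -/

import Mathlib

open Set Filter Topology MeasureTheory

noncomputable section

namespace PhaseTransition

/-! ### One measure -/

/-- `ℓ_η = inf supp η ∈ [-∞, ∞)`. -/
def leftEnd (η : Measure ℝ) : EReal := sInf ((fun x : ℝ => (x : EReal)) '' η.support)

/-- `r_η = sup supp η ∈ (-∞, ∞]`. -/
def rightEnd (η : Measure ℝ) : EReal := sSup ((fun x : ℝ => (x : EReal)) '' η.support)

/-- The real points of the open interval `(ℓ_η, r_η)`. -/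
def suppInterval (η : Measure ℝ) : Set ℝ :=
  {x : ℝ | leftEnd η < (x : EReal) ∧ (x : EReal) < rightEnd η}

/-- `C_η(k) = ∫ (x - k)⁺ η(dx)`. -/
def callFun (η : Measure ℝ) (k : ℝ) : ℝ := ∫ x, max (x - k) 0 ∂η

/-! ### Two measures -/

/-- The convex-decreasing order `η ≤_cd θ` of integrable measures on the line. A convex function
is bounded below by an affine one, so its integrals always exist in `(-∞, ∞]`; only test functions
with finite integrals are used here, and among them are all `x ↦ (k - x)⁺` and `x ↦ -x`, which
already determine the order. -/
def ConvexDecreasingLE (η θ : Measure ℝ) : Prop :=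
  ∀ φ : ℝ → ℝ, ConvexOn ℝ univ φ → Antitone φ → Integrable φ η → Integrable φ θ →
    ∫ x, φ x ∂η ≤ ∫ x, φ x ∂θ

/-- `c^{η,θ}(x) = sup_k { C_{η|[x,∞)}(k) - C_θ(k) }`. -/
def shortfall (η θ : Measure ℝ) (x : ℝ) : ℝ :=
  ⨆ k : ℝ, (callFun (η.restrict (Ici x)) k - callFun θ k)

open Classical in
/-- The first point, coming from the right, at which the decreasing supermartingale coupling of
`η` and `θ` passes from martingale to supermartingale transport:
`inf {x ∈ ℝ : c^{η,θ}(x) = 0}`, with `inf ∅ = r_η`. It is an extended real number. -/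
def phasePoint (η θ : Measure ℝ) : EReal :=
  if {x : ℝ | shortfall η θ x = 0}.Nonempty then
    sInf ((fun x : ℝ => (x : EReal)) '' {x : ℝ | shortfall η θ x = 0})
  else rightEnd η

/-! ### A family of marginals, indexed by `t ∈ [0, 1]`

Values of the family at times outside `[0, 1]` are never used. -/

/-- The distribution function `F(t, x)`. -/
def distF (μ : ℝ → ProbabilityMeasure ℝ) (t x : ℝ) : ℝ :=
  ProbabilityTheory.cdf (μ t : Measure ℝ) x

/-- The density `f(t, x) = ∂ₓF(t, x)`. -/
def dens (μ : ℝ → ProbabilityMeasure ℝ) (t x : ℝ) : ℝ := deriv (distF μ t) x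

/-- `∂ₜF(t, x)`, one-sided at the times `0` and `1`. -/
def dtF (μ : ℝ → ProbabilityMeasure ℝ) (t x : ℝ) : ℝ :=
  derivWithin (fun s => distF μ s x) (Icc 0 1) t

/-- `∂ₜf(t, x)`, one-sided at the times `0` and `1`. -/
def dtDens (μ : ℝ → ProbabilityMeasure ℝ) (t x : ℝ) : ℝ :=
  derivWithin (fun s => dens μ s x) (Icc 0 1) t

/-- `E = {(t, x) : t ∈ [0, 1], x ∈ (ℓ_t, r_t)}`. -/
def domE (μ : ℝ → ProbabilityMeasure ℝ) : Set (ℝ × ℝ) :=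
  {p | p.1 ∈ Icc (0 : ℝ) 1 ∧ p.2 ∈ suppInterval (μ p.1 : Measure ℝ)}

/-- `C_b^n(A)`: derivatives up to order `n` exist on `A`, are continuous and bounded. -/
def IsCb (n : ℕ) (G : ℝ × ℝ → ℝ) (A : Set (ℝ × ℝ)) : Prop :=
  ContDiffOn ℝ n G A ∧
    ∀ k ≤ n, ∃ B : ℝ, ∀ p ∈ A, ‖iteratedFDerivWithin ℝ k G A p‖ ≤ B

/-- The dispersion condition for the marginals at the times `t` and `t + ε`, with the crossing
points `a = m_ε(t)` and `b = m^ε(t)` of the two densities. -/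
structure Dispersion (μ : ℝ → ProbabilityMeasure ℝ) (t ε a b : ℝ) : Prop where
  left_le : leftEnd (μ (t + ε) : Measure ℝ) ≤ leftEnd (μ t : Measure ℝ)
  left_le_a : leftEnd (μ t : Measure ℝ) ≤ (a : EReal)
  a_lt_b : a < b
  b_le_right : (b : EReal) ≤ rightEnd (μ t : Measure ℝ)
  right_le : rightEnd (μ t : Measure ℝ) ≤ rightEnd (μ (t + ε) : Measure ℝ)
  left_lt : leftEnd (μ (t + ε) : Measure ℝ) < max (leftEnd (μ t : Measure ℝ)) (a : EReal)
  lt_right : min (b : EReal) (rightEnd (μ t : Measure ℝ)) < rightEnd (μ (t + ε) : Measure ℝ)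
  middle : ∀ x ∈ Ioo a b, dens μ (t + ε) x < dens μ t x
  crossing : ∀ x : ℝ, x = a ∨ x = b → x ∈ suppInterval (μ t : Measure ℝ) →
    dens μ (t + ε) x = dens μ t x
  left_tail : ∀ x : ℝ, leftEnd (μ (t + ε) : Measure ℝ) < (x : EReal) → x < a →
    dens μ t x < dens μ (t + ε) x
  right_tail : ∀ x : ℝ, b < x → (x : EReal) < rightEnd (μ (t + ε) : Measure ℝ) →
    dens μ t x < dens μ (t + ε) x

/-- The assumption on the marginals: order, weak continuity, smoothness, positive density,
dispersion. Here `mLow t ε = m_ε(t)` and `mUp t ε = m^ε(t)`. -/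
structure MarginalAssumption (μ : ℝ → ProbabilityMeasure ℝ) (ε₁ : ℝ) (mLow mUp : ℝ → ℝ → ℝ) :
    Prop where
  integrable : ∀ t ∈ Icc (0 : ℝ) 1, Integrable (fun x : ℝ => x) (μ t : Measure ℝ)
  order : ∀ s ∈ Icc (0 : ℝ) 1, ∀ t ∈ Icc (0 : ℝ) 1, s ≤ t →
    ConvexDecreasingLE (μ s : Measure ℝ) (μ t : Measure ℝ)
  continuous : ContinuousOn μ (Icc 0 1)
  smooth : IsCb 4 (fun p => distF μ p.1 p.2) (domE μ)
  abs_cont : ∀ t ∈ Icc (0 : ℝ) 1, (μ t : Measure ℝ) ≪ volume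
  dens_pos : ∀ t ∈ Icc (0 : ℝ) 1, ∀ x ∈ suppInterval (μ t : Measure ℝ), 0 < dens μ t x
  eps_pos : 0 < ε₁
  eps_le : ε₁ ≤ 1
  dispersion : ∀ t ∈ Ico (0 : ℝ) 1, ∀ ε : ℝ, 0 < ε → ε ≤ min ε₁ (1 - t) →
    Dispersion μ t ε (mLow t ε) (mUp t ε)

/-- The assumption on the local extrema of `∂ₜF(t, ·)` over `(ℓ_t, r_t)`. The unique local
minimizer is `m_t = mUp t 0`. The unique local maximizer is `mTilde t`; as for `m_ε(t)`, the left
end point `ℓ_t` is admitted, in which case there is no local maximizer inside the interval. -/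
structure ExtremaAssumption (μ : ℝ → ProbabilityMeasure ℝ) (ε₁ ε₂ : ℝ) (mUp : ℝ → ℝ → ℝ)
    (mTilde : ℝ → ℝ) : Prop where
  eps_pos : 0 < ε₂
  localMin : ∀ t ∈ Icc (0 : ℝ) 1,
    {x ∈ suppInterval (μ t : Measure ℝ) | IsLocalMin (dtF μ t) x} = {mUp t 0}
  mTilde_mem : ∀ t ∈ Icc (0 : ℝ) 1,
    leftEnd (μ t : Measure ℝ) ≤ (mTilde t : EReal) ∧
      (mTilde t : EReal) < rightEnd (μ t : Measure ℝ)
  localMax : ∀ t ∈ Icc (0 : ℝ) 1,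
    {x ∈ suppInterval (μ t : Measure ℝ) | IsLocalMax (dtF μ t) x} =
      {mTilde t} ∩ suppInterval (μ t : Measure ℝ)
  continuous : ContinuousOn (fun p : ℝ × ℝ => mUp p.1 p.2)
    {p | 0 ≤ p.2 ∧ p.2 ≤ min ε₁ ε₂ ∧ 0 ≤ p.1 ∧ p.1 ≤ 1 - p.2}

/-- `x_1^ε(t)`, the phase transition point of the marginals at the times `t` and `t + ε`. -/
def phaseEps (μ : ℝ → ProbabilityMeasure ℝ) (t ε : ℝ) : EReal :=
  phasePoint (μ t : Measure ℝ) (μ (t + ε) : Measure ℝ)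

/-- `{(t, ε) : 0 < ε ≤ ε₀, 0 ≤ t ≤ 1 - ε}`. -/
def stepDomain (ε₀ : ℝ) : Set (ℝ × ℝ) :=
  {p | 0 < p.2 ∧ p.2 ≤ ε₀ ∧ 0 ≤ p.1 ∧ p.1 ≤ 1 - p.2}

/-- The map `(t, ε) ↦ x_1^ε(t)` is bounded (in particular real-valued) and uniformly continuous on
`{0 < ε ≤ ε₀, 0 ≤ t ≤ 1 - ε}`, and `r_t` does not depend on `t`. -/
structure TransitionAssumption (μ : ℝ → ProbabilityMeasure ℝ) (ε₀ : ℝ) : Prop where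
  bounded : ∃ B : ℝ, ∀ p ∈ stepDomain ε₀,
    ((-B : ℝ) : EReal) ≤ phaseEps μ p.1 p.2 ∧ phaseEps μ p.1 p.2 ≤ (B : EReal)
  uniformContinuous :
    UniformContinuousOn (fun p : ℝ × ℝ => (phaseEps μ p.1 p.2).toReal) (stepDomain ε₀)
  right_const : ∃ r : EReal, ∀ t ∈ Icc (0 : ℝ) 1, rightEnd (μ t : Measure ℝ) = r

/-- The improper integrals `∫^∞ ξ ∂ₜf(t, ξ) dξ` converge absolutely, uniformly in `t ∈ [0, 1]`:
`sup_t ∫_K^∞ |ξ ∂ₜf(t, ξ)| dξ → 0` as `K → ∞`. (Nothing is required if `r_t = r < ∞`.) -/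
def UniformTail (μ : ℝ → ProbabilityMeasure ℝ) : Prop :=
  ∀ η : ℝ, 0 < η → ∃ K : ℝ, ∀ t ∈ Icc (0 : ℝ) 1,
    ∫⁻ ξ in Ioi K, ENNReal.ofReal |ξ * dtDens μ t ξ| ≤ ENNReal.ofReal η

end PhaseTransition

end

namespace PhaseTransition

/-! ### Support and density of one measure -/

/-! Write `K(t, x)` for `callRate`, the time derivative of `C_{μ_t}(x)`. The integral in the theorem
is `-K(t, x)`, so `x₁(t)` has to be the only zero of `K(t, ·)` in `[ℓ_t, r)`. That a continuous
limit `x₁` exists is mere extension of a uniformly continuous function to `ε = 0`; the work lies in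
locating it.

To the left of `x` the call function of `μ_t|[x, ∞)` is the tangent of `C_{μ_t}` at `x`, and to the
right it is `C_{μ_t}` itself. So `x` has zero shortfall iff `C_{μ_{t+ε}}` dominates this tangent and
that branch. If `K(t, x) < 0`, domination already fails at the strike `x` for small `ε`, and the
phase point is at least `x` (`eventually_le_phaseEps`). If `K(t, x) > 0` inside the support,
domination holds for small `ε`, and the phase point is at most `x` (`eventually_phaseEps_le`). With
continuity of `K` this leaves `K(t, x₁(t)) = 0` whenever `x₁(t) > ℓ_t`. On the left edge only `K ≥
0` follows in this way. The other sign comes from continuity of `t ↦ K(t, x₁(t))`, or, if `x₁`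
follows the left edge for a while, from the decreasing means (`callRate_nonpos_of_leftEnd`). Time
`1` follows by continuity.

Uniqueness is a matter of shape. Dispersion makes each increment of the call function quasi-concave
in the strike, hence also `K(t, ·)`. Moreover `K ≥ 0` to the right of `m_t`, and `K` vanishes on no
interval, since there `∂ₜF` would vanish too and have many local minimizers. Two zeros are
incompatible with this (`callRate_zero_unique`). -/

lemma measure_Iio_eq_zero {η : Measure ℝ} {x : ℝ} (h : (x : EReal) ≤ leftEnd η) :
    η (Iio x) = 0 := by
  refine measure_mono_null (t := η.supportᶜ) (fun y hy hys => ?_) Measure.measure_compl_support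
  have h2 : leftEnd η ≤ (y : EReal) := sInf_le ⟨y, hys, rfl⟩
  exact not_le.2 hy (EReal.coe_le_coe_iff.1 (h.trans h2))

lemma measure_Ioi_eq_zero {η : Measure ℝ} {x : ℝ} (h : rightEnd η ≤ (x : EReal)) :
    η (Ioi x) = 0 := by
  refine measure_mono_null (t := η.supportᶜ) (fun y hy hys => ?_) Measure.measure_compl_support
  have h2 : (y : EReal) ≤ rightEnd η := le_sSup ⟨y, hys, rfl⟩
  exact not_le.2 hy (EReal.coe_le_coe_iff.1 (h2.trans h))

lemma measure_Iio_pos {η : Measure ℝ} {x : ℝ} (h : leftEnd η < (x : EReal)) :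
    0 < η (Iio x) := by
  obtain ⟨_, ⟨y, hy, rfl⟩, hyx⟩ := sInf_lt_iff.1 h
  exact (Measure.mem_support_iff_forall y).1 hy _ (Iio_mem_nhds (EReal.coe_lt_coe_iff.1 hyx))

lemma deriv_cdf_eq_zero_of_lt {η : Measure ℝ} [IsProbabilityMeasure η] {x : ℝ}
    (h : (x : EReal) < leftEnd η) : deriv (ProbabilityTheory.cdf η) x = 0 := by
  obtain ⟨y, hxy, hy⟩ := EReal.lt_iff_exists_real_btwn.1 h
  have h0 : ∀ᶠ z in 𝓝 x, ProbabilityTheory.cdf η z = (fun _ => (0 : ℝ)) z := by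
    filter_upwards [Iio_mem_nhds (EReal.coe_lt_coe_iff.1 hxy)] with z hz
    rw [ProbabilityTheory.cdf_eq_real, measureReal_def,
      measure_mono_null (Iic_subset_Iio.2 hz) (measure_Iio_eq_zero hy.le), ENNReal.toReal_zero]
  rw [EventuallyEq.deriv_eq h0, deriv_const]

lemma deriv_cdf_eq_zero_of_gt {η : Measure ℝ} [IsProbabilityMeasure η] {x : ℝ}
    (h : rightEnd η < (x : EReal)) : deriv (ProbabilityTheory.cdf η) x = 0 := by
  obtain ⟨y, hy, hxy⟩ := EReal.lt_iff_exists_real_btwn.1 h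
  have h0 : ∀ᶠ z in 𝓝 x, ProbabilityTheory.cdf η z = (fun _ => (1 : ℝ)) z := by
    filter_upwards [Ioi_mem_nhds (EReal.coe_lt_coe_iff.1 hxy)] with z hz
    have hz' : y < z := hz
    have : η (Iic z)ᶜ = 0 := by
      rw [compl_Iic]
      exact measure_mono_null (Ioi_subset_Ioi hz'.le) (measure_Ioi_eq_zero hy.le)
    rw [ProbabilityTheory.cdf_eq_real]
    rw [measureReal_def, (prob_compl_eq_zero_iff measurableSet_Iic).1 this, ENNReal.toReal_one]
  rw [EventuallyEq.deriv_eq h0, deriv_const]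

variable {η : Measure ℝ} [IsProbabilityMeasure η]

lemma deriv_cdf_ae_eq (η : Measure ℝ) [IsProbabilityMeasure η] :
    deriv (ProbabilityTheory.cdf η) =ᵐ[volume] fun x => (η.rnDeriv volume x).toReal := by
  filter_upwards [(ProbabilityTheory.cdf η).ae_hasDerivAt] with x hx
  rw [hx.deriv, ProbabilityTheory.measure_cdf]

lemma deriv_cdf_nonneg (η : Measure ℝ) (x : ℝ) : 0 ≤ deriv (ProbabilityTheory.cdf η) x :=
  (ProbabilityTheory.monotone_cdf η).deriv_nonneg

lemma setIntegral_eq_setIntegral_mul_deriv_cdf (hη : η ≪ volume) (φ : ℝ → ℝ) {s : Set ℝ}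
    (hs : MeasurableSet s) :
    ∫ x in s, φ x ∂η = ∫ x in s, φ x * deriv (ProbabilityTheory.cdf η) x := by
  rw [← setIntegral_rnDeriv_smul hη hs]
  refine integral_congr_ae (ae_restrict_of_ae ?_)
  filter_upwards [deriv_cdf_ae_eq η] with x hx
  rw [hx, smul_eq_mul, mul_comm]

lemma integrable_mul_deriv_cdf (hη : η ≪ volume) {φ : ℝ → ℝ} (hφ : Integrable φ η) :
    Integrable (fun x => φ x * deriv (ProbabilityTheory.cdf η) x) := by
  refine ((integrable_rnDeriv_smul_iff hη).2 hφ).congr ?_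
  filter_upwards [deriv_cdf_ae_eq η] with x hx
  rw [hx, smul_eq_mul, mul_comm]

lemma integrable_deriv_cdf (hη : η ≪ volume) :
    Integrable (fun x => deriv (ProbabilityTheory.cdf η) x) := by
  simpa using integrable_mul_deriv_cdf hη (integrable_const (1 : ℝ))

lemma measureReal_eq_integral_deriv_cdf (hη : η ≪ volume) {s : Set ℝ} (hs : MeasurableSet s) :
    η.real s = ∫ x in s, deriv (ProbabilityTheory.cdf η) x := by
  have := setIntegral_eq_setIntegral_mul_deriv_cdf hη (fun _ => (1 : ℝ)) hs
  simpa using this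

/-! ### Call functions -/

lemma integrable_sub_const {η : Measure ℝ} [IsFiniteMeasure η]
    (hi : Integrable (fun x : ℝ => x) η) (k : ℝ) : Integrable (fun x : ℝ => x - k) η :=
  hi.sub (integrable_const k)

lemma integrable_call {η : Measure ℝ} [IsFiniteMeasure η] (hi : Integrable (fun x : ℝ => x) η)
    (k : ℝ) : Integrable (fun x : ℝ => max (x - k) 0) η :=
  (integrable_sub_const hi k).sup (integrable_zero _ _ _)

lemma callFun_eq_setIntegral (η : Measure ℝ) (k : ℝ) :
    callFun η k = ∫ x in Ioi k, (x - k) ∂η := by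
  rw [callFun, ← integral_indicator measurableSet_Ioi]
  congr 1
  ext x
  by_cases hx : k < x
  · rw [indicator_of_mem (show x ∈ Ioi k from hx), max_eq_left (by linarith)]
  · rw [indicator_of_notMem (show x ∉ Ioi k from hx), max_eq_right (by linarith)]

lemma callFun_eq_integral_deriv_cdf (hη : η ≪ volume) (k : ℝ) :
    callFun η k = ∫ x in Ioi k, (x - k) * deriv (ProbabilityTheory.cdf η) x := by
  rw [callFun_eq_setIntegral, setIntegral_eq_setIntegral_mul_deriv_cdf hη _ measurableSet_Ioi]

lemma callFun_nonneg (η : Measure ℝ) (k : ℝ) : 0 ≤ callFun η k :=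
  integral_nonneg fun _ => le_max_right _ _

lemma convexOn_callFun {η : Measure ℝ} [IsFiniteMeasure η]
    (hi : Integrable (fun x : ℝ => x) η) : ConvexOn ℝ univ (callFun η) := by
  refine ⟨convex_univ, fun x _ y _ a b ha hb hab => ?_⟩
  simp only [callFun, smul_eq_mul]
  rw [← integral_const_mul, ← integral_const_mul, ← integral_add
    ((integrable_call hi x).const_mul a) ((integrable_call hi y).const_mul b)]
  refine integral_mono (integrable_call hi _)
    (((integrable_call hi x).const_mul a).add ((integrable_call hi y).const_mul b)) fun z => ?_
  have h1 := mul_le_mul_of_nonneg_left (le_max_left (z - x) 0) ha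
  have h2 := mul_le_mul_of_nonneg_left (le_max_left (z - y) 0) hb
  have h3 := mul_nonneg ha (le_max_right (z - x) 0)
  have h4 := mul_nonneg hb (le_max_right (z - y) 0)
  refine max_le ?_ (add_nonneg h3 h4)
  have : z = a * z + b * z := by rw [← add_mul, hab, one_mul]
  dsimp only
  linarith

lemma tendsto_callFun_atTop {η : Measure ℝ} (hi : Integrable (fun x : ℝ => x) η) :
    Tendsto (callFun η) atTop (𝓝 0) := by
  rw [← integral_zero ℝ ℝ (μ := η)]
  refine tendsto_integral_filter_of_dominated_convergence (fun x => |x|) ?_ ?_ hi.abs ?_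
  · exact .of_forall fun k => by fun_prop
  · filter_upwards [eventually_ge_atTop 0] with k hk
    refine .of_forall fun x => ?_
    rw [Real.norm_of_nonneg (le_max_right _ _)]
    exact max_le (by linarith [le_abs_self x]) (abs_nonneg x)
  · refine .of_forall fun x => tendsto_const_nhds.congr' ?_
    filter_upwards [eventually_ge_atTop x] with k hk
    rw [max_eq_right (by linarith)]

lemma callFun_restrict_le {η : Measure ℝ} [IsFiniteMeasure η]
    (hi : Integrable (fun x : ℝ => x) η) (s : Set ℝ) (k : ℝ) :
    callFun (η.restrict s) k ≤ callFun η k :=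
  setIntegral_le_integral (integrable_call hi k) (.of_forall fun _ => le_max_right _ _)

lemma callFun_restrict_Ici_anti {η : Measure ℝ} [IsFiniteMeasure η]
    (hi : Integrable (fun x : ℝ => x) η) {x y : ℝ} (hxy : x ≤ y) (k : ℝ) :
    callFun (η.restrict (Ici y)) k ≤ callFun (η.restrict (Ici x)) k :=
  setIntegral_mono_set (integrable_call hi k).integrableOn
    (.of_forall fun _ => le_max_right _ _) (Ici_subset_Ici.2 hxy).eventuallyLE

/-- All the mass left by the restriction lies above the strike, so the call is affine in `k`: it is
the supporting line of `callFun η` at `x`. -/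
lemma callFun_restrict_Ici {η : Measure ℝ} [IsFiniteMeasure η]
    (hi : Integrable (fun x : ℝ => x) η) {x k : ℝ} (hk : k ≤ x) :
    callFun (η.restrict (Ici x)) k = callFun η x + (x - k) * η.real (Ici x) := by
  have e1 : callFun η x = ∫ z in Ici x, (z - x) ∂η := by
    rw [callFun, ← integral_indicator measurableSet_Ici]
    congr 1
    ext z
    by_cases hz : x ≤ z
    · rw [indicator_of_mem (show z ∈ Ici x from hz), max_eq_left (by linarith)]
    · rw [indicator_of_notMem (show z ∉ Ici x from hz), max_eq_right (by linarith)]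
  have e2 : callFun (η.restrict (Ici x)) k = ∫ z in Ici x, ((z - x) + (x - k)) ∂η := by
    refine setIntegral_congr_fun measurableSet_Ici fun z hz => ?_
    have : x ≤ z := hz
    rw [max_eq_left (by linarith)]
    ring
  rw [e2, integral_add (integrable_sub_const hi x).integrableOn
    (integrable_const (x - k)).integrableOn, ← e1, setIntegral_const, smul_eq_mul, mul_comm]

/-- The mass in `(y, x)` pays at strike `y` but is removed by the restriction. This strict gap
leaves room for the perturbation in `eventually_phaseEps_le`. -/
lemma callFun_sub_tangent_pos {η : Measure ℝ} [IsFiniteMeasure η]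
    (hi : Integrable (fun x : ℝ => x) η) {x y : ℝ} (h : 0 < η (Ioo y x)) :
    callFun (η.restrict (Ici x)) y < callFun η y := by
  have hd := integral_add_compl (μ := η) (f := fun z => max (z - y) 0)
    (measurableSet_Ici (a := x)) (integrable_call hi y)
  have : 0 < ∫ z in (Ici x)ᶜ, max (z - y) 0 ∂η := by
    rw [setIntegral_pos_iff_support_of_nonneg_ae (f := fun z => max (z - y) 0)
      (.of_forall fun _ => le_max_right _ _) (integrable_call hi y).integrableOn]
    refine h.trans_le (measure_mono fun z hz => ⟨?_, by simpa using hz.2⟩)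
    exact (lt_max_of_lt_left (sub_pos.2 hz.1)).ne'
  simp only [callFun]
  linarith

lemma abs_callFun_sub_le (hi : Integrable (fun x : ℝ => x) η) (k : ℝ) :
    |callFun η k - max (-k) 0| ≤ ∫ x, |x| ∂η := by
  have : callFun η k - max (-k) 0 = ∫ x, (max (x - k) 0 - max (-k) 0) ∂η := by
    rw [integral_sub (integrable_call hi k) (integrable_const _)]
    simp [callFun]
  rw [this]
  refine (abs_integral_le_integral_abs).trans
    (integral_mono ((integrable_call hi k).sub (integrable_const _)).abs hi.abs fun x => ?_)
  have := abs_max_sub_max_le_abs (x - k) (-k) 0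
  simpa using this

/-! ### Shortfall and phase point of two measures -/

/-- Both call functions stay within a first absolute moment of `(-k)⁺`. Boundedness matters because
the real `⨆` of an unbounded family is `0`, the very value tested in `phasePoint`. -/
lemma bddAbove_shortfall {θ : Measure ℝ} [IsProbabilityMeasure θ]
    (hi : Integrable (fun x : ℝ => x) η) (hi' : Integrable (fun x : ℝ => x) θ) (x : ℝ) :
    BddAbove (range fun k : ℝ => callFun (η.restrict (Ici x)) k - callFun θ k) := by
  refine ⟨(∫ x, |x| ∂η) + ∫ x, |x| ∂θ, ?_⟩
  rintro _ ⟨k, rfl⟩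
  have h1 := abs_le.1 (abs_callFun_sub_le hi k)
  have h2 := abs_le.1 (abs_callFun_sub_le hi' k)
  have h3 := callFun_restrict_le hi (Ici x) k
  dsimp only
  linarith [h1.2, h2.1]

/-- Both calls vanish as `k → ∞`, so the supremum is never negative and its vanishing is a pure
domination statement. -/
lemma shortfall_eq_zero_iff {θ : Measure ℝ} [IsProbabilityMeasure θ]
    (hi : Integrable (fun x : ℝ => x) η) (hi' : Integrable (fun x : ℝ => x) θ) (x : ℝ) :
    shortfall η θ x = 0 ↔ ∀ k, callFun (η.restrict (Ici x)) k ≤ callFun θ k := by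
  constructor
  · intro h k
    have := le_ciSup (bddAbove_shortfall hi hi' x) k
    rw [shortfall] at h
    linarith
  · intro h
    refine le_antisymm (ciSup_le fun k => sub_nonpos.2 (h k)) ?_
    refine le_of_tendsto (f := fun k => - callFun θ k) (x := atTop) (b := shortfall η θ x) ?_
      (.of_forall fun k => ?_)
    · simpa using (tendsto_callFun_atTop hi').neg
    · refine le_trans ?_ (le_ciSup (bddAbove_shortfall hi hi' x) k)
      have := callFun_nonneg (η.restrict (Ici x)) k
      linarith

lemma phasePoint_le {η θ : Measure ℝ} {x : ℝ} (h : shortfall η θ x = 0) :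
    phasePoint η θ ≤ x := by
  rw [phasePoint, if_pos ⟨x, h⟩]
  exact sInf_le ⟨x, h, rfl⟩

/-- Restricting to `[y, ∞)` with `y < x` keeps all the mass that pays at strike `x`, so the failure
at this single strike excludes every such `y`. The bound by `rightEnd η` serves the convention for
`inf ∅`. -/
lemma le_phasePoint_of_callFun_lt {θ : Measure ℝ} [IsProbabilityMeasure θ]
    (hi : Integrable (fun x : ℝ => x) η) (hi' : Integrable (fun x : ℝ => x) θ) {x : ℝ}
    (hx : (x : EReal) ≤ rightEnd η) (h : callFun θ x < callFun η x) :
    (x : EReal) ≤ phasePoint η θ := by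
  rw [phasePoint]
  split_ifs with hne
  · refine le_sInf ?_
    rintro _ ⟨y, hy, rfl⟩
    by_contra! hlt
    have hyx : y < x := EReal.coe_lt_coe_iff.1 hlt
    have h1 := (shortfall_eq_zero_iff hi hi' y).1 hy x
    have h2 := callFun_restrict_Ici_anti hi hyx.le x
    rw [callFun_restrict_Ici hi le_rfl] at h2
    simp only [sub_self, zero_mul, add_zero] at h2
    linarith
  · exact hx

/-- Unless the phase point is `-∞`, it is not to the left of the support. -/
lemma leftEnd_le_phasePoint {θ : Measure ℝ} [IsProbabilityMeasure θ]
    (hi : Integrable (fun x : ℝ => x) η) (hi' : Integrable (fun x : ℝ => x) θ)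
    (hlr : leftEnd η ≤ rightEnd η) (hbot : phasePoint η θ ≠ ⊥) :
    leftEnd η ≤ phasePoint η θ := by
  rw [phasePoint]
  split_ifs with hne
  · refine le_sInf ?_
    rintro _ ⟨y, hy, rfl⟩
    by_contra! hlt
    refine hbot ?_
    have h0 : ∀ k, callFun (η.restrict (Ici y)) k = callFun η k := fun k => by
      have : η.restrict (Ici y) = η := by
        refine Measure.restrict_eq_self_of_ae_mem ?_
        have := measure_Iio_eq_zero hlt.le
        rw [← compl_Ici] at this
        exact this
      rw [this]
    -- A zero to the left of the support means domination by `θ` of the whole of `η`. Then every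
    -- real is a zero and the infimum is `-∞`.
    have h1 : ∀ z, shortfall η θ z = 0 := fun z => by
      rw [shortfall_eq_zero_iff hi hi']
      intro k
      have := (shortfall_eq_zero_iff hi hi' y).1 hy k
      rw [h0] at this
      exact (callFun_restrict_le hi _ k).trans this
    rw [EReal.eq_bot_iff_forall_lt]
    intro z
    exact (phasePoint_le (h1 (z - 1))).trans_lt (EReal.coe_lt_coe_iff.2 (by linarith))
  · exact hlr

end PhaseTransition

namespace PhaseTransition

variable {μ : ℝ → ProbabilityMeasure ℝ} {ε₁ : ℝ} {mLow mUp : ℝ → ℝ → ℝ}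

/-! ### Regularity on the domain `E` -/

lemma MarginalAssumption.leftEnd_anti (h₁ : MarginalAssumption μ ε₁ mLow mUp) {s t : ℝ}
    (hs : 0 ≤ s) (ht : t ≤ 1) (hst : s ≤ t) (hts : t ≤ s + ε₁) :
    leftEnd (μ t : Measure ℝ) ≤ leftEnd (μ s : Measure ℝ) := by
  rcases hst.eq_or_lt with rfl | hlt
  · exact le_rfl
  · have := (h₁.dispersion s ⟨hs, hlt.trans_le ht⟩ (t - s) (by linarith)
      (le_min (by linarith) (by linarith))).left_le
    rwa [add_sub_cancel] at this

lemma leftEnd_lt_of_measure_Iio_pos {η : Measure ℝ} {x : ℝ} (h : 0 < η (Iio x)) :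
    leftEnd η < (x : EReal) := by
  by_contra! hx
  exact h.ne' (measure_Iio_eq_zero hx)

/-- By the portmanteau theorem the mass of the open half-line below `x` is lower semicontinuous in
time, so its positivity persists. -/
lemma MarginalAssumption.eventually_leftEnd_lt (h₁ : MarginalAssumption μ ε₁ mLow mUp) {t x : ℝ}
    (ht : t ∈ Icc (0 : ℝ) 1) (hx : leftEnd (μ t : Measure ℝ) < (x : EReal)) :
    ∀ᶠ s in 𝓝[Icc 0 1] t, leftEnd (μ s : Measure ℝ) < (x : EReal) := by
  have h := ProbabilityMeasure.le_liminf_measure_open_of_tendsto (h₁.continuous t ht)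
    (isOpen_Iio (a := x))
  filter_upwards [eventually_lt_of_lt_liminf ((measure_Iio_pos hx).trans_le h)] with s hs
  exact leftEnd_lt_of_measure_Iio_pos hs

/-- `E` is relatively open in the strip `[0, 1] × ℝ`: the left end is upper semicontinuous and the
right end constant. Derivatives within `E` can therefore be computed within the strip, one-sided at
the times `0` and `1`. -/
lemma MarginalAssumption.domE_mem_nhdsWithin (h₁ : MarginalAssumption μ ε₁ mLow mUp)
    {ρ : EReal} (hr : ∀ t ∈ Icc (0 : ℝ) 1, rightEnd (μ t : Measure ℝ) = ρ) {p : ℝ × ℝ}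
    (hp : p ∈ domE μ) : domE μ ∈ 𝓝[Icc (0 : ℝ) 1 ×ˢ univ] p := by
  obtain ⟨t, x⟩ := p
  obtain ⟨ht, hl, hx⟩ := hp
  simp only at ht hl hx
  obtain ⟨y, hly, hyx⟩ := EReal.lt_iff_exists_real_btwn.1 hl
  rw [hr t ht] at hx
  obtain ⟨z, hxz, hzr⟩ := EReal.lt_iff_exists_real_btwn.1 hx
  rw [nhdsWithin_prod_eq, nhdsWithin_univ]
  filter_upwards [prod_mem_prod (inter_mem (h₁.eventually_leftEnd_lt ht hly) self_mem_nhdsWithin)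
    (Ioo_mem_nhds (EReal.coe_lt_coe_iff.1 hyx) (EReal.coe_lt_coe_iff.1 hxz))]
  rintro ⟨s, w⟩ ⟨⟨hs1, hs2⟩, hw1, hw2⟩
  refine ⟨hs2, lt_trans hs1 (EReal.coe_lt_coe_iff.2 hw1), ?_⟩
  simp only [hr s hs2]
  exact lt_trans (EReal.coe_lt_coe_iff.2 hw2) hzr

lemma MarginalAssumption.nhdsWithin_domE (h₁ : MarginalAssumption μ ε₁ mLow mUp)
    {ρ : EReal} (hr : ∀ t ∈ Icc (0 : ℝ) 1, rightEnd (μ t : Measure ℝ) = ρ) {p : ℝ × ℝ}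
    (hp : p ∈ domE μ) : 𝓝[domE μ] p = 𝓝[Icc (0 : ℝ) 1 ×ˢ univ] p :=
  le_antisymm (nhdsWithin_mono _ fun _ hq => ⟨hq.1, mem_univ _⟩)
    (nhdsWithin_le_iff.2 (h₁.domE_mem_nhdsWithin hr hp))

lemma MarginalAssumption.uniqueDiffOn_domE (h₁ : MarginalAssumption μ ε₁ mLow mUp)
    {ρ : EReal} (hr : ∀ t ∈ Icc (0 : ℝ) 1, rightEnd (μ t : Measure ℝ) = ρ) :
    UniqueDiffOn ℝ (domE μ) := fun p hp => by
  refine UniqueDiffWithinAt.mono_nhds ?_ (h₁.nhdsWithin_domE hr hp).ge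
  exact ((uniqueDiffOn_Icc zero_lt_one).prod uniqueDiffOn_univ) p ⟨hp.1, mem_univ _⟩

lemma MarginalAssumption.measurableSet_domE (h₁ : MarginalAssumption μ ε₁ mLow mUp)
    {ρ : EReal} (hr : ∀ t ∈ Icc (0 : ℝ) 1, rightEnd (μ t : Measure ℝ) = ρ) :
    MeasurableSet (domE μ) := by
  have h := fun p : domE μ => mem_nhdsWithin.1 (h₁.domE_mem_nhdsWithin hr p.2)
  choose u hu hpu hsub using h
  have : domE μ = (⋃ p, u p) ∩ (Icc (0 : ℝ) 1 ×ˢ univ) := by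
    ext q
    constructor
    · exact fun hq => ⟨mem_iUnion.2 ⟨⟨q, hq⟩, hpu ⟨q, hq⟩⟩, hq.1, mem_univ _⟩
    · rintro ⟨hq1, hq2⟩
      obtain ⟨p, hp⟩ := mem_iUnion.1 hq1
      exact hsub p ⟨hp, hq2⟩
  rw [this]
  exact (isOpen_iUnion hu).measurableSet.inter (measurableSet_Icc.prod MeasurableSet.univ)

lemma MarginalAssumption.time_mem (h₁ : MarginalAssumption μ ε₁ mLow mUp)
    {ρ : EReal} (hr : ∀ t ∈ Icc (0 : ℝ) 1, rightEnd (μ t : Measure ℝ) = ρ) {t x : ℝ}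
    (hp : (t, x) ∈ domE μ) : ∀ᶠ s in 𝓝[Icc 0 1] t, (s, x) ∈ domE μ := by
  have hc : Tendsto (fun s : ℝ => (s, x)) (𝓝[Icc 0 1] t) (𝓝[Icc (0 : ℝ) 1 ×ˢ univ] (t, x)) := by
    refine tendsto_nhdsWithin_iff.2 ⟨?_, ?_⟩
    · exact (Continuous.tendsto (by fun_prop) t).mono_left nhdsWithin_le_nhds
    · filter_upwards [self_mem_nhdsWithin] with s hs using ⟨hs, mem_univ _⟩
  exact hc.eventually (h₁.domE_mem_nhdsWithin hr hp)

lemma MarginalAssumption.hasDerivWithinAt_time (h₁ : MarginalAssumption μ ε₁ mLow mUp)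
    {ρ : EReal} (hr : ∀ t ∈ Icc (0 : ℝ) 1, rightEnd (μ t : Measure ℝ) = ρ) {t x : ℝ}
    (hp : (t, x) ∈ domE μ) {G : ℝ × ℝ → ℝ} (hG : DifferentiableWithinAt ℝ G (domE μ) (t, x)) :
    HasDerivWithinAt (fun s => G (s, x)) (fderivWithin ℝ G (domE μ) (t, x) (1, 0))
      (Icc 0 1) t := by
  have hc : HasDerivWithinAt (fun s : ℝ => (s, x)) ((1 : ℝ), (0 : ℝ))
      ((fun s : ℝ => (s, x)) ⁻¹' domE μ) t :=
    (hasDerivWithinAt_id _ _).prodMk (hasDerivWithinAt_const _ _ _)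
  have := hG.hasFDerivWithinAt.comp_hasDerivWithinAt t hc (fun _ h => h)
  exact this.mono_of_mem_nhdsWithin (h₁.time_mem hr hp)

lemma MarginalAssumption.hasDerivAt_space {t x : ℝ}
    (hp : (t, x) ∈ domE μ) {G : ℝ × ℝ → ℝ} (hG : DifferentiableWithinAt ℝ G (domE μ) (t, x)) :
    HasDerivAt (fun y => G (t, y)) (fderivWithin ℝ G (domE μ) (t, x) (0, 1)) x := by
  have hc : HasDerivWithinAt (fun y : ℝ => (t, y)) ((0 : ℝ), (1 : ℝ))
      ((fun y : ℝ => (t, y)) ⁻¹' domE μ) x :=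
    (hasDerivWithinAt_const _ _ _).prodMk (hasDerivWithinAt_id _ _)
  have := hG.hasFDerivWithinAt.comp_hasDerivWithinAt x hc (fun _ h => h)
  refine this.hasDerivAt ?_
  obtain ⟨ht, hl, hx⟩ := hp
  have hopen : IsOpen (suppInterval (μ t : Measure ℝ)) :=
    isOpen_Ioo.preimage continuous_coe_real_ereal
  filter_upwards [hopen.mem_nhds ⟨hl, hx⟩] with y hy using ⟨ht, hy⟩

lemma MarginalAssumption.dens_eq (h₁ : MarginalAssumption μ ε₁ mLow mUp) {p : ℝ × ℝ}
    (hp : p ∈ domE μ) :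
    dens μ p.1 p.2
      = fderivWithin ℝ (fun p : ℝ × ℝ => distF μ p.1 p.2) (domE μ) p (0, 1) :=
  (hasDerivAt_space hp (h₁.smooth.1.differentiableOn (by norm_num) p hp)).deriv

lemma MarginalAssumption.contDiffOn_dens (h₁ : MarginalAssumption μ ε₁ mLow mUp)
    {ρ : EReal} (hr : ∀ t ∈ Icc (0 : ℝ) 1, rightEnd (μ t : Measure ℝ) = ρ) :
    ContDiffOn ℝ 3 (fun p : ℝ × ℝ => dens μ p.1 p.2) (domE μ) := by
  have h := h₁.smooth.1.fderivWithin (m := 3) (h₁.uniqueDiffOn_domE hr) (by norm_num)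
  exact (h.clm_apply (contDiffOn_const (c := ((0 : ℝ), (1 : ℝ))))).congr
    fun p hp => h₁.dens_eq hp

lemma MarginalAssumption.hasDerivWithinAt_dens (h₁ : MarginalAssumption μ ε₁ mLow mUp)
    {ρ : EReal} (hr : ∀ t ∈ Icc (0 : ℝ) 1, rightEnd (μ t : Measure ℝ) = ρ) {t x : ℝ}
    (hp : (t, x) ∈ domE μ) :
    HasDerivWithinAt (fun s => dens μ s x) (dtDens μ t x) (Icc 0 1) t :=
  (h₁.hasDerivWithinAt_time hr hp ((h₁.contDiffOn_dens hr).differentiableOn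
    (by norm_num) _ hp)).differentiableWithinAt.hasDerivWithinAt

lemma MarginalAssumption.dtDens_eq (h₁ : MarginalAssumption μ ε₁ mLow mUp)
    {ρ : EReal} (hr : ∀ t ∈ Icc (0 : ℝ) 1, rightEnd (μ t : Measure ℝ) = ρ) {p : ℝ × ℝ}
    (hp : p ∈ domE μ) :
    dtDens μ p.1 p.2
      = fderivWithin ℝ (fun p : ℝ × ℝ => dens μ p.1 p.2) (domE μ) p (1, 0) :=
  (h₁.hasDerivWithinAt_time hr hp ((h₁.contDiffOn_dens hr).differentiableOn
    (by norm_num) _ hp)).derivWithin (uniqueDiffOn_Icc zero_lt_one _ hp.1)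

lemma MarginalAssumption.continuousOn_dtDens (h₁ : MarginalAssumption μ ε₁ mLow mUp)
    {ρ : EReal} (hr : ∀ t ∈ Icc (0 : ℝ) 1, rightEnd (μ t : Measure ℝ) = ρ) :
    ContinuousOn (fun p : ℝ × ℝ => dtDens μ p.1 p.2) (domE μ) :=
  (((h₁.contDiffOn_dens hr).continuousOn_fderivWithin (h₁.uniqueDiffOn_domE hr)
    (by norm_num)).clm_apply (continuousOn_const (c := ((1 : ℝ), (0 : ℝ))))).congr
    fun p hp => h₁.dtDens_eq hr hp

/-- `∂ₜf` is the mixed entry of the second derivative of `F`, and both coordinate vectors have norm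
one. -/
lemma MarginalAssumption.exists_abs_dtDens_le (h₁ : MarginalAssumption μ ε₁ mLow mUp)
    {ρ : EReal} (hr : ∀ t ∈ Icc (0 : ℝ) 1, rightEnd (μ t : Measure ℝ) = ρ) :
    ∃ B : ℝ, 0 ≤ B ∧ ∀ p ∈ domE μ, |dtDens μ p.1 p.2| ≤ B := by
  obtain ⟨B, hB⟩ := h₁.smooth.2 2 (by norm_num)
  refine ⟨max B 0, le_max_right _ _, fun p hp => le_trans ?_ (le_max_left _ _)⟩
  have hu := h₁.uniqueDiffOn_domE hr
  have hd : DifferentiableWithinAt ℝ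
      (fderivWithin ℝ (fun p : ℝ × ℝ => distF μ p.1 p.2) (domE μ)) (domE μ) p :=
    (h₁.smooth.1.fderivWithin (m := 3) hu (by norm_num)).differentiableOn (by norm_num) p hp
  have key : dtDens μ p.1 p.2 = iteratedFDerivWithin ℝ 2 (fun p : ℝ × ℝ => distF μ p.1 p.2)
      (domE μ) p ![(1, 0), (0, 1)] := by
    rw [iteratedFDerivWithin_two_apply _ hu hp, h₁.dtDens_eq hr hp,
      fderivWithin_congr (fun q hq => h₁.dens_eq hq) (h₁.dens_eq hp),
      fderivWithin_clm_apply (hu p hp) hd (differentiableWithinAt_const _)]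
    simp
  rw [key, ← Real.norm_eq_abs]
  refine (ContinuousMultilinearMap.le_opNorm _ _).trans ?_
  refine le_trans (le_of_eq ?_) (hB p hp)
  simp [Fin.prod_univ_two]

end PhaseTransition

namespace PhaseTransition

variable {μ : ℝ → ProbabilityMeasure ℝ} {ε₁ : ℝ} {mLow mUp : ℝ → ℝ → ℝ} {ρ : EReal}

/-! ### Upper partial moments of `∂ₜf` -/

/-- A family of marginals with common right end `ρ` and uniformly integrable `∂ₜf`. -/
structure RegularFamily (μ : ℝ → ProbabilityMeasure ℝ) (ε₁ : ℝ) (mLow mUp : ℝ → ℝ → ℝ)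
    (ρ : EReal) : Prop where
  marg : MarginalAssumption μ ε₁ mLow mUp
  right : ∀ t ∈ Icc (0 : ℝ) 1, rightEnd (μ t : Measure ℝ) = ρ
  tail : UniformTail μ

/-- `∂ₜf` on `E`, extended by zero. -/
noncomputable def ker (μ : ℝ → ProbabilityMeasure ℝ) : ℝ × ℝ → ℝ :=
  indicator (domE μ) fun p => dtDens μ p.1 p.2

/-- `{(t, x) : t ∈ [0, 1], ℓ_t ≤ x < ρ}`. -/
def closE (μ : ℝ → ProbabilityMeasure ℝ) (ρ : EReal) : Set (ℝ × ℝ) :=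
  {p | p.1 ∈ Icc (0 : ℝ) 1 ∧ leftEnd (μ p.1 : Measure ℝ) ≤ (p.2 : EReal) ∧ (p.2 : EReal) < ρ}

/-- `∫_x^∞ (α + β ξ) ∂ₜf(t, ξ) dξ`. -/
noncomputable def tailInt (μ : ℝ → ProbabilityMeasure ℝ) (α β : ℝ) (p : ℝ × ℝ) : ℝ :=
  ∫ ξ in Ioi p.2, (α + β * ξ) * ker μ (p.1, ξ)

lemma ae_ne_ereal (ρ : EReal) : ∀ᵐ ξ : ℝ, (ξ : EReal) ≠ ρ := by
  have : ({ξ : ℝ | (ξ : EReal) = ρ}).Subsingleton := fun a ha b hb =>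
    EReal.coe_injective (ha.trans hb.symm)
  rw [ae_iff]
  simpa using this.measure_zero volume

namespace RegularFamily

lemma measurable_ker (S : RegularFamily μ ε₁ mLow mUp ρ) : Measurable (ker μ) := by
  classical
  have h := ContinuousOn.measurable_piecewise (g := fun _ => (0 : ℝ))
    (S.marg.continuousOn_dtDens S.right) continuousOn_const (S.marg.measurableSet_domE S.right)
  rw [ker, ← piecewise_eq_indicator]
  exact h

lemma exists_abs_ker_le (S : RegularFamily μ ε₁ mLow mUp ρ) :
    ∃ B : ℝ, 0 ≤ B ∧ ∀ p, |ker μ p| ≤ B := by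
  obtain ⟨B, hB0, hB⟩ := S.marg.exists_abs_dtDens_le S.right
  refine ⟨B, hB0, fun p => ?_⟩
  by_cases hp : p ∈ domE μ
  · rw [ker, indicator_of_mem hp]
    exact hB p hp
  · rw [ker, indicator_of_notMem hp, abs_zero]
    exact hB0

lemma mem_domE (S : RegularFamily μ ε₁ mLow mUp ρ) {t x : ℝ} (ht : t ∈ Icc (0 : ℝ) 1)
    (hl : leftEnd (μ t : Measure ℝ) < (x : EReal)) (hx : (x : EReal) < ρ) : (t, x) ∈ domE μ :=
  ⟨ht, hl, by simpa only [S.right t ht] using hx⟩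

lemma mem_domE_of_closE (S : RegularFamily μ ε₁ mLow mUp ρ) {t x ξ : ℝ} (hp : (t, x) ∈ closE μ ρ)
    (hx : x < ξ) (hξ : (ξ : EReal) < ρ) : (t, ξ) ∈ domE μ :=
  S.mem_domE hp.1 (lt_of_le_of_lt hp.2.1 (EReal.coe_lt_coe_iff.2 hx)) hξ

lemma domE_subset_closE (S : RegularFamily μ ε₁ mLow mUp ρ) : domE μ ⊆ closE μ ρ := by
  rintro ⟨t, x⟩ ⟨ht, hl, hx⟩
  exact ⟨ht, hl.le, by simpa only [S.right t ht] using hx⟩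

lemma ker_of_gt (S : RegularFamily μ ε₁ mLow mUp ρ) {t ξ : ℝ} (hξ : ρ < (ξ : EReal)) :
    ker μ (t, ξ) = 0 := by
  refine indicator_of_notMem (fun h => ?_) _
  have := h.2.2
  rw [S.right t h.1] at this
  exact lt_asymm this hξ

lemma dens_of_gt (S : RegularFamily μ ε₁ mLow mUp ρ) {t ξ : ℝ} (ht : t ∈ Icc (0 : ℝ) 1)
    (hξ : ρ < (ξ : EReal)) : dens μ t ξ = 0 :=
  deriv_cdf_eq_zero_of_gt (by rwa [S.right t ht])

lemma dtDens_eq_ker (S : RegularFamily μ ε₁ mLow mUp ρ) {t x : ℝ} (hp : (t, x) ∈ closE μ ρ) :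
    ∀ᵐ ξ, x < ξ → dtDens μ t ξ = ker μ (t, ξ) := by
  filter_upwards [ae_ne_ereal ρ] with ξ hne hξ
  rcases lt_or_gt_of_ne hne with h | h
  · rw [ker, indicator_of_mem (S.mem_domE_of_closE hp hξ h)]
  · rw [S.ker_of_gt h, dtDens,
      derivWithin_congr (f := fun _ => (0 : ℝ)) (fun s hs => S.dens_of_gt hs h)
        (S.dens_of_gt hp.1 h)]
    simp

lemma abs_ker_le_abs_dtDens (p : ℝ × ℝ) : |ker μ p| ≤ |dtDens μ p.1 p.2| := by
  rw [ker]
  exact norm_indicator_le_norm_self (fun p : ℝ × ℝ => dtDens μ p.1 p.2) p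

lemma exists_tail_le (S : RegularFamily μ ε₁ mLow mUp ρ) (α β : ℝ) {δ : ℝ} (hδ : 0 < δ) :
    ∃ K : ℝ, ∀ t ∈ Icc (0 : ℝ) 1,
      ∫⁻ ξ in Ioi K, ENNReal.ofReal |(α + β * ξ) * ker μ (t, ξ)| ≤ ENNReal.ofReal δ := by
  have hc : 0 < |α| + |β| + 1 := by positivity
  obtain ⟨K, hK⟩ := S.tail (δ / (|α| + |β| + 1)) (by positivity)
  -- Beyond `1` the affine weight is at most `(|α| + |β| + 1) ξ`, so the tail assumption on `ξ ∂ₜf`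
  -- also covers constant weights.
  refine ⟨max K 1, fun t ht => ?_⟩
  calc ∫⁻ ξ in Ioi (max K 1), ENNReal.ofReal |(α + β * ξ) * ker μ (t, ξ)|
      ≤ ∫⁻ ξ in Ioi (max K 1),
          ENNReal.ofReal (|α| + |β| + 1) * ENNReal.ofReal |ξ * dtDens μ t ξ| := by
        refine setLIntegral_mono' measurableSet_Ioi fun ξ hξ => ?_
        rw [← ENNReal.ofReal_mul hc.le]
        refine ENNReal.ofReal_le_ofReal ?_
        have h1 : 1 ≤ ξ := (le_max_right K 1).trans (le_of_lt hξ)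
        rw [abs_mul, abs_mul, ← mul_assoc]
        refine mul_le_mul ?_ (abs_ker_le_abs_dtDens (t, ξ)) (abs_nonneg _) (by positivity)
        rw [abs_of_nonneg (zero_le_one.trans h1)]
        have h2 := abs_add_le α (β * ξ)
        rw [abs_mul, abs_of_nonneg (zero_le_one.trans h1)] at h2
        nlinarith [abs_nonneg α]
    _ = ENNReal.ofReal (|α| + |β| + 1) *
          ∫⁻ ξ in Ioi (max K 1), ENNReal.ofReal |ξ * dtDens μ t ξ| :=
        lintegral_const_mul' _ _ ENNReal.ofReal_ne_top
    _ ≤ ENNReal.ofReal (|α| + |β| + 1) * ENNReal.ofReal (δ / (|α| + |β| + 1)) := by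
        gcongr
        exact (lintegral_mono_set (Ioi_subset_Ioi (le_max_left _ _))).trans (hK t ht)
    _ = ENNReal.ofReal δ := by
        rw [← ENNReal.ofReal_mul hc.le, mul_div_cancel₀ _ hc.ne']

lemma exists_lintegral_le (S : RegularFamily μ ε₁ mLow mUp ρ) (α β x : ℝ) :
    ∃ M : ℝ, 0 ≤ M ∧ ∀ t ∈ Icc (0 : ℝ) 1,
      ∫⁻ ξ in Ioi x, ENNReal.ofReal |(α + β * ξ) * ker μ (t, ξ)| ≤ ENNReal.ofReal M := by
  obtain ⟨K, hK⟩ := S.exists_tail_le α β one_pos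
  obtain ⟨B, hB0, hB⟩ := S.exists_abs_ker_le
  have hc : 0 ≤ (|α| + |β| * (|x| + |K|)) * B := by positivity
  refine ⟨(|α| + |β| * (|x| + |K|)) * B * max (K - x) 0 + 1, by positivity, fun t ht => ?_⟩
  have hsub : Ioi x ⊆ Ioc x K ∪ Ioi K := fun ξ hξ => by
    rcases le_or_gt ξ K with h | h
    · exact Or.inl ⟨hξ, h⟩
    · exact Or.inr h
  refine (lintegral_mono_set hsub).trans ((lintegral_union_le _ _ _).trans ?_)
  rw [ENNReal.ofReal_add (by positivity) zero_le_one]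
  refine add_le_add ?_ (hK t ht)
  calc ∫⁻ ξ in Ioc x K, ENNReal.ofReal |(α + β * ξ) * ker μ (t, ξ)|
      ≤ ∫⁻ ξ in Ioc x K, ENNReal.ofReal ((|α| + |β| * (|x| + |K|)) * B) := by
        refine setLIntegral_mono' measurableSet_Ioc fun ξ hξ => ENNReal.ofReal_le_ofReal ?_
        rw [abs_mul]
        refine mul_le_mul ?_ (hB _) (abs_nonneg _) (by positivity)
        refine (abs_add_le _ _).trans ?_
        rw [abs_mul]
        have : |ξ| ≤ |x| + |K| := by
          rw [abs_le]
          constructor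
          · linarith [hξ.1, neg_abs_le x, abs_nonneg K]
          · linarith [hξ.2, le_abs_self K, abs_nonneg x]
        gcongr
    _ = ENNReal.ofReal ((|α| + |β| * (|x| + |K|)) * B * max (K - x) 0) := by
        rw [setLIntegral_const, Real.volume_Ioc, ENNReal.ofReal_mul hc]
        congr 1
        rw [ENNReal.ofReal_max, ENNReal.ofReal_zero, max_eq_left zero_le]
    _ ≤ _ := le_rfl

lemma measurable_weight_ker (S : RegularFamily μ ε₁ mLow mUp ρ) (α β : ℝ) :
    Measurable fun p : ℝ × ℝ => (α + β * p.2) * ker μ p :=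
  (by fun_prop : Measurable fun p : ℝ × ℝ => α + β * p.2).mul S.measurable_ker

lemma integrableOn_weight_ker (S : RegularFamily μ ε₁ mLow mUp ρ) (α β x : ℝ) {t : ℝ}
    (ht : t ∈ Icc (0 : ℝ) 1) :
    IntegrableOn (fun ξ => (α + β * ξ) * ker μ (t, ξ)) (Ioi x) := by
  obtain ⟨M, -, hM⟩ := S.exists_lintegral_le α β x
  refine ⟨((S.measurable_weight_ker α β).comp measurable_prodMk_left).aestronglyMeasurable, ?_⟩
  rw [hasFiniteIntegral_iff_norm]
  exact (hM t ht).trans_lt ENNReal.ofReal_lt_top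

/-- Dominated convergence, with a constant bound on a bounded interval. For fixed `ξ` with `x < ξ <
ρ` the point `(t, ξ)` lies in `E`, where the kernel is continuous, even if `x` is on the left edge;
`ξ = x` and `ξ = ρ` are null. -/
lemma continuousOn_truncated (S : RegularFamily μ ε₁ mLow mUp ρ) (α β K : ℝ) :
    ContinuousOn (fun p : ℝ × ℝ => ∫ ξ in Ioi p.2 ∩ Iic K, (α + β * ξ) * ker μ (p.1, ξ))
      (closE μ ρ) := by
  rintro ⟨t, x⟩ hp
  obtain ⟨B, hB0, hB⟩ := S.exists_abs_ker_le
  simp_rw [ContinuousWithinAt,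
    ← integral_indicator (measurableSet_Ioi.inter (measurableSet_Iic (a := K)))]
  have hfst : Tendsto (fun p : ℝ × ℝ => p.1) (𝓝[closE μ ρ] (t, x)) (𝓝 t) :=
    (continuous_fst.tendsto (t, x)).mono_left nhdsWithin_le_nhds
  have hsnd : Tendsto (fun p : ℝ × ℝ => p.2) (𝓝[closE μ ρ] (t, x)) (𝓝 x) :=
    (continuous_snd.tendsto (t, x)).mono_left nhdsWithin_le_nhds
  refine tendsto_integral_filter_of_dominated_convergence
    (indicator (Ioc (x - 1) K) fun _ => (|α| + |β| * (|x - 1| + |K|)) * B) ?_ ?_ ?_ ?_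
  · refine .of_forall fun p => ?_
    exact (((S.measurable_weight_ker α β).comp measurable_prodMk_left).indicator
      (measurableSet_Ioi.inter measurableSet_Iic)).aestronglyMeasurable
  · filter_upwards [hsnd.eventually (lt_mem_nhds (show x - 1 < x by linarith))] with p hpx
    refine .of_forall fun ξ => ?_
    by_cases hξ : ξ ∈ Ioi p.2 ∩ Iic K
    · have h2 : ξ ∈ Ioc (x - 1) K := ⟨hpx.trans hξ.1, hξ.2⟩
      rw [indicator_of_mem hξ, indicator_of_mem h2, Real.norm_eq_abs, abs_mul]
      refine mul_le_mul ?_ (hB _) (abs_nonneg _) (by positivity)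
      refine (abs_add_le _ _).trans ?_
      rw [abs_mul]
      have : |ξ| ≤ |x - 1| + |K| := by
        rw [abs_le]
        constructor
        · linarith [h2.1, neg_abs_le (x - 1), abs_nonneg K]
        · linarith [h2.2, le_abs_self K, abs_nonneg (x - 1)]
      gcongr
    · rw [indicator_of_notMem hξ, norm_zero]
      exact indicator_nonneg (fun _ _ => by positivity) _
  · exact (integrable_indicator_iff measurableSet_Ioc).2
      (integrableOn_const (by simp))
  · filter_upwards [ae_ne_ereal ρ, Measure.ae_ne volume x] with ξ hρ hx
    rcases lt_or_gt_of_ne hx with h | h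
    · rw [indicator_of_notMem (fun h' => lt_asymm h h'.1)]
      refine tendsto_const_nhds.congr' ?_
      filter_upwards [hsnd.eventually (lt_mem_nhds h)] with p hpξ
      rw [indicator_of_notMem (fun h' => lt_asymm hpξ h'.1)]
    · by_cases hK : ξ ≤ K
      · rw [indicator_of_mem (show ξ ∈ Ioi x ∩ Iic K from ⟨h, hK⟩)]
        suffices hk : Tendsto (fun p : ℝ × ℝ => ker μ (p.1, ξ)) (𝓝[closE μ ρ] (t, x))
            (𝓝 (ker μ (t, ξ))) by
          refine (hk.const_mul (α + β * ξ)).congr' ?_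
          filter_upwards [hsnd.eventually (gt_mem_nhds h)] with p hpξ
          rw [indicator_of_mem (show ξ ∈ Ioi p.2 ∩ Iic K from ⟨hpξ, hK⟩)]
        rcases lt_or_gt_of_ne hρ with hρ | hρ
        · have hE := S.mem_domE_of_closE hp h hρ
          have hc : Tendsto (fun p : ℝ × ℝ => (p.1, ξ)) (𝓝[closE μ ρ] (t, x))
              (𝓝[domE μ] (t, ξ)) := by
            rw [S.marg.nhdsWithin_domE S.right hE]
            refine tendsto_nhdsWithin_iff.2 ⟨hfst.prodMk_nhds tendsto_const_nhds, ?_⟩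
            filter_upwards [self_mem_nhdsWithin] with p hp' using ⟨hp'.1, mem_univ _⟩
          have hk : ContinuousWithinAt (ker μ) (domE μ) (t, ξ) :=
            ((S.marg.continuousOn_dtDens S.right) _ hE).congr
              (fun q hq => indicator_of_mem hq _) (indicator_of_mem hE _)
          exact hk.tendsto.comp hc
        · simp_rw [S.ker_of_gt hρ]
          exact tendsto_const_nhds
      · have h0 : ∀ y, ξ ∉ Ioi y ∩ Iic K := fun y h' => hK h'.2
        simp_rw [indicator_of_notMem (h0 _)]
        exact tendsto_const_nhds

/-- The truncated integrals converge uniformly, since the tail bound does not depend on `t`. -/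
lemma continuousOn_tailInt (S : RegularFamily μ ε₁ mLow mUp ρ) (α β : ℝ) :
    ContinuousOn (tailInt μ α β) (closE μ ρ) := by
  refine continuousOn_of_uniform_approx_of_continuousOn fun u hu => ?_
  obtain ⟨δ, hδ, hu⟩ := Metric.mem_uniformity_dist.1 hu
  obtain ⟨K, hK⟩ := S.exists_tail_le α β (half_pos hδ)
  refine ⟨_, S.continuousOn_truncated α β K, fun p hp => hu ?_⟩
  have h := integral_inter_add_sdiff (measurableSet_Iic (a := K))
    (S.integrableOn_weight_ker α β p.2 hp.1)
  rw [tailInt, ← h, Real.dist_eq, add_sub_cancel_left]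
  refine lt_of_le_of_lt ?_ (half_lt_self hδ)
  refine (norm_integral_le_lintegral_norm
    (fun ξ => (α + β * ξ) * ker μ (p.1, ξ))).trans ?_
  refine ENNReal.toReal_le_of_le_ofReal (half_pos hδ).le ?_
  refine (lintegral_mono_set fun ξ hξ => ?_).trans (hK p.1 hp.1)
  simpa using hξ.2

lemma stronglyMeasurable_tailInt (S : RegularFamily μ ε₁ mLow mUp ρ) (α β x : ℝ) :
    StronglyMeasurable fun t => tailInt μ α β (t, x) :=
  (S.measurable_weight_ker α β).stronglyMeasurable.integral_prod_right'
    (ν := volume.restrict (Ioi x))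

lemma integrable_prod_weight_ker (S : RegularFamily μ ε₁ mLow mUp ρ) (α β x : ℝ) {t s : ℝ}
    (ht : 0 ≤ t) (hs : s ≤ 1) :
    Integrable (fun p : ℝ × ℝ => (α + β * p.2) * ker μ p)
      ((volume.restrict (Ioc t s)).prod (volume.restrict (Ioi x))) := by
  obtain ⟨M, -, hM⟩ := S.exists_lintegral_le α β x
  refine ⟨(S.measurable_weight_ker α β).aestronglyMeasurable, ?_⟩
  rw [hasFiniteIntegral_iff_norm, lintegral_prod _
    ((S.measurable_weight_ker α β).norm.ennreal_ofReal.aemeasurable)]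
  calc _ ≤ ∫⁻ _ in Ioc t s, ENNReal.ofReal M := by
        refine setLIntegral_mono' measurableSet_Ioc fun u hu => ?_
        exact hM u ⟨ht.trans hu.1.le, hu.2.trans hs⟩
    _ < ⊤ := by
        rw [setLIntegral_const, Real.volume_Ioc]
        exact ENNReal.mul_lt_top ENNReal.ofReal_lt_top ENNReal.ofReal_lt_top

/-- Left ends move to the left, so a point of the left edge stays in `closE` forward in time, but
perhaps not backward. Hence time derivatives on the edge are right-sided. -/
lemma mem_closE_of_le (S : RegularFamily μ ε₁ mLow mUp ρ) {t x s : ℝ} (hp : (t, x) ∈ closE μ ρ)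
    (hts : t ≤ s) (hs : s ≤ 1) (hs' : s ≤ t + ε₁) : (s, x) ∈ closE μ ρ :=
  ⟨⟨hp.1.1.trans hts, hs⟩, (S.marg.leftEnd_anti hp.1.1 hs hts hs').trans hp.2.1, hp.2.2⟩

lemma integral_ker_time (S : RegularFamily μ ε₁ mLow mUp ρ) {t x s ξ : ℝ}
    (hp : (t, x) ∈ closE μ ρ) (hts : t ≤ s) (hs : s ≤ 1) (hs' : s ≤ t + ε₁) (hξ : x < ξ)
    (hρ : (ξ : EReal) ≠ ρ) :
    ∫ u in Ioc t s, ker μ (u, ξ) = dens μ s ξ - dens μ t ξ := by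
  rcases lt_or_gt_of_ne hρ with h | h
  · have hE : ∀ u ∈ Icc t s, (u, ξ) ∈ domE μ := fun u hu =>
      S.mem_domE_of_closE (S.mem_closE_of_le hp hu.1 (hu.2.trans hs) (hu.2.trans hs')) hξ h
    have hsub : Icc t s ⊆ Icc (0 : ℝ) 1 := Icc_subset_Icc hp.1.1 hs
    rw [← intervalIntegral.integral_of_le hts]
    refine intervalIntegral.integral_eq_sub_of_hasDerivAt_of_le (f := fun u => dens μ u ξ)
      hts ?_ ?_ ?_
    · exact fun u hu =>
        (S.marg.hasDerivWithinAt_dens S.right (hE u hu)).continuousWithinAt.mono hsub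
    · intro u hu
      have h1 := S.marg.hasDerivWithinAt_dens S.right (hE u (Ioo_subset_Icc_self hu))
      rw [ker, indicator_of_mem (hE u (Ioo_subset_Icc_self hu))]
      exact h1.hasDerivAt (Icc_mem_nhds (hp.1.1.trans_lt hu.1) (hu.2.trans_le hs))
    · rw [intervalIntegrable_iff_integrableOn_Ioc_of_le hts]
      obtain ⟨B, -, hB⟩ := S.exists_abs_ker_le
      exact Measure.integrableOn_of_bounded (M := B) (by simp)
        (S.measurable_ker.comp measurable_prodMk_right).aestronglyMeasurable
        (.of_forall fun u => hB _)
  · simp_rw [S.ker_of_gt h]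
    rw [S.dens_of_gt ⟨hp.1.1.trans hts, hs⟩ h, S.dens_of_gt hp.1 h]
    simp

/-- Fundamental theorem of calculus in time, then Fubini. The weight `1` yields increments of
distribution functions, the weight `ξ - x` those of call functions. -/
lemma integral_weight_dens_sub (S : RegularFamily μ ε₁ mLow mUp ρ) (α β : ℝ) {t x s : ℝ}
    (hp : (t, x) ∈ closE μ ρ) (hts : t ≤ s) (hs : s ≤ 1) (hs' : s ≤ t + ε₁) :
    ∫ ξ in Ioi x, (α + β * ξ) * (dens μ s ξ - dens μ t ξ)
      = ∫ u in t..s, tailInt μ α β (u, x) := by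
  rw [intervalIntegral.integral_of_le hts]
  simp only [tailInt]
  rw [integral_integral_swap (S.integrable_prod_weight_ker α β x hp.1.1 hs)]
  refine integral_congr_ae ?_
  filter_upwards [ae_restrict_mem measurableSet_Ioi, ae_restrict_of_ae (ae_ne_ereal ρ)]
    with ξ hξ hρ
  rw [integral_const_mul, S.integral_ker_time hp hts hs hs' hξ hρ]

end RegularFamily
end PhaseTransition

namespace PhaseTransition

variable {μ : ℝ → ProbabilityMeasure ℝ} {ε₁ : ℝ} {mLow mUp : ℝ → ℝ → ℝ} {ρ : EReal}

/-! ### Increments of call functions and distribution functions -/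

/-- Increments of `x ↦ ∫_x^∞ (ξ - x) q(ξ) dξ`. -/
lemma integral_sub_mul_sub_eq {q : ℝ → ℝ} {x y : ℝ} (hxy : x ≤ y) (hq : IntegrableOn q (Ioi x))
    (hq' : IntegrableOn (fun ξ => ξ * q ξ) (Ioi x)) :
    (∫ ξ in Ioi x, (ξ - x) * q ξ) - ∫ ξ in Ioi y, (ξ - y) * q ξ
      = ∫ z in x..y, ∫ ξ in Ioi z, q ξ := by
  have hmeas : MeasurableSet {p : ℝ × ℝ | p.1 < p.2} :=
    measurableSet_lt measurable_fst measurable_snd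
  have hprod : Integrable (fun p : ℝ × ℝ => indicator {p : ℝ × ℝ | p.1 < p.2}
      (fun p => q p.2) p) ((volume.restrict (Ioc x y)).prod (volume.restrict (Ioi x))) := by
    have h1 : Integrable (fun _ : ℝ => (1 : ℝ)) (volume.restrict (Ioc x y)) :=
      integrableOn_const (by simp)
    have := h1.mul_prod (ν := volume.restrict (Ioi x)) hq
    simp only [one_mul] at this
    exact this.indicator hmeas
  have hsub : ∀ a : ℝ, IntegrableOn (fun ξ => (ξ - a) * q ξ) (Ioi x) := fun a => by
    simp only [sub_mul]
    exact hq'.sub (hq.const_mul a)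
  -- Fubini: `(ξ - x) - (ξ - y)⁺` is the length of the set of `z ∈ (x, y]` below `ξ`.
  have hR : ∫ z in x..y, ∫ ξ in Ioi z, q ξ
      = ∫ ξ in Ioi x, ∫ z in Ioc x y, indicator {p : ℝ × ℝ | p.1 < p.2} (fun p => q p.2) (z, ξ) := by
    rw [intervalIntegral.integral_of_le hxy, ← integral_integral_swap hprod]
    refine setIntegral_congr_fun measurableSet_Ioc fun z hz => ?_
    have e : (fun ξ => indicator {p : ℝ × ℝ | p.1 < p.2} (fun p => q p.2) (z, ξ))
        = indicator (Ioi z) q := by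
      ext ξ
      simp [indicator]
    simp only [e]
    rw [setIntegral_indicator measurableSet_Ioi, inter_eq_self_of_subset_right
      (Ioi_subset_Ioi hz.1.le)]
  have hL : ∫ ξ in Ioi y, (ξ - y) * q ξ
      = ∫ ξ in Ioi x, indicator (Ioi y) (fun ξ => (ξ - y) * q ξ) ξ := by
    rw [setIntegral_indicator measurableSet_Ioi, inter_eq_self_of_subset_right
      (Ioi_subset_Ioi hxy)]
  rw [hR, hL, ← integral_sub (hsub x) ((hsub y).indicator measurableSet_Ioi)]
  refine setIntegral_congr_fun measurableSet_Ioi fun ξ hξ => ?_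
  have hξ' : x < ξ := hξ
  have e : (fun z => indicator {p : ℝ × ℝ | p.1 < p.2} (fun p => q p.2) (z, ξ))
      = indicator (Iio ξ) (fun _ => q ξ) := by
    ext z
    simp [indicator]
  simp only [e]
  rw [setIntegral_indicator measurableSet_Iio, setIntegral_const, smul_eq_mul]
  by_cases h : y < ξ
  · have : Ioc x y ∩ Iio ξ = Ioc x y := inter_eq_self_of_subset_left fun z hz => hz.2.trans_lt h
    rw [this, indicator_of_mem (show ξ ∈ Ioi y from h), Real.volume_real_Ioc_of_le hxy]
    ring
  · have : Ioc x y ∩ Iio ξ = Ioo x ξ := by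
      ext z
      exact ⟨fun hz => ⟨hz.1.1, hz.2⟩, fun hz => ⟨⟨hz.1, hz.2.le.trans (not_lt.1 h)⟩, hz.2⟩⟩
    rw [this, indicator_of_notMem (show ξ ∉ Ioi y from h), Real.volume_real_Ioo_of_le hξ'.le]
    ring

lemma tendsto_const_add_nhdsGT (t : ℝ) :
    Tendsto (fun ε : ℝ => t + ε) (𝓝[>] 0) (𝓝[>] t) := by
  refine tendsto_nhdsWithin_iff.2 ⟨?_, ?_⟩
  · have : Tendsto (fun ε : ℝ => t + ε) (𝓝 0) (𝓝 (t + 0)) := Continuous.tendsto (by fun_prop) 0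
    rw [add_zero] at this
    exact this.mono_left nhdsWithin_le_nhds
  · filter_upwards [self_mem_nhdsWithin] with ε hε
    exact lt_add_of_pos_right t hε

/-- `∂ₜ ∫ (ξ - x)⁺ μ_t(dξ)`. -/
noncomputable def callRate (μ : ℝ → ProbabilityMeasure ℝ) (p : ℝ × ℝ) : ℝ :=
  tailInt μ (-p.2) 1 p

namespace MarginalAssumption

lemma integrable_dens (h₁ : MarginalAssumption μ ε₁ mLow mUp) {t : ℝ} (ht : t ∈ Icc (0 : ℝ) 1) :
    Integrable (dens μ t) :=
  integrable_deriv_cdf (h₁.abs_cont t ht)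

lemma integrable_mul_dens (h₁ : MarginalAssumption μ ε₁ mLow mUp) {t : ℝ}
    (ht : t ∈ Icc (0 : ℝ) 1) : Integrable (fun ξ => ξ * dens μ t ξ) :=
  integrable_mul_deriv_cdf (h₁.abs_cont t ht) (h₁.integrable t ht)

lemma one_sub_distF (h₁ : MarginalAssumption μ ε₁ mLow mUp) {t : ℝ} (ht : t ∈ Icc (0 : ℝ) 1)
    (x : ℝ) : 1 - distF μ t x = ∫ ξ in Ioi x, dens μ t ξ := by
  rw [distF, ProbabilityTheory.cdf_eq_real, ← probReal_compl_eq_one_sub measurableSet_Iic,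
    compl_Iic, measureReal_eq_integral_deriv_cdf (h₁.abs_cont t ht) measurableSet_Ioi]
  rfl

lemma distF_sub (h₁ : MarginalAssumption μ ε₁ mLow mUp) {s t : ℝ} (hs : s ∈ Icc (0 : ℝ) 1)
    (ht : t ∈ Icc (0 : ℝ) 1) (x : ℝ) :
    distF μ s x - distF μ t x = -∫ ξ in Ioi x, (dens μ s ξ - dens μ t ξ) := by
  rw [integral_sub (h₁.integrable_dens hs).integrableOn (h₁.integrable_dens ht).integrableOn,
    ← h₁.one_sub_distF hs, ← h₁.one_sub_distF ht]
  ring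

lemma distF_eq (h₁ : MarginalAssumption μ ε₁ mLow mUp) {t : ℝ} (ht : t ∈ Icc (0 : ℝ) 1)
    (x : ℝ) : distF μ t x = ∫ ξ in Iic x, dens μ t ξ := by
  rw [distF, ProbabilityTheory.cdf_eq_real,
    measureReal_eq_integral_deriv_cdf (h₁.abs_cont t ht) measurableSet_Iic]
  rfl

lemma callFun_sub (h₁ : MarginalAssumption μ ε₁ mLow mUp) {s t : ℝ} (hs : s ∈ Icc (0 : ℝ) 1)
    (ht : t ∈ Icc (0 : ℝ) 1) (x : ℝ) :
    callFun (μ s : Measure ℝ) x - callFun (μ t : Measure ℝ) x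
      = ∫ ξ in Ioi x, (ξ - x) * (dens μ s ξ - dens μ t ξ) := by
  have hi : ∀ u ∈ Icc (0 : ℝ) 1, Integrable (fun ξ => (ξ - x) * dens μ u ξ) := fun u hu => by
    simp only [sub_mul]
    exact (h₁.integrable_mul_dens hu).sub ((h₁.integrable_dens hu).const_mul x)
  rw [callFun_eq_integral_deriv_cdf (h₁.abs_cont s hs),
    callFun_eq_integral_deriv_cdf (h₁.abs_cont t ht)]
  simp_rw [mul_sub]
  exact (integral_sub (hi s hs).integrableOn (hi t ht).integrableOn).symm

/-- The difference of call functions is a primitive of that of the distribution functions. -/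
lemma callFun_sub_increment (h₁ : MarginalAssumption μ ε₁ mLow mUp) {s t : ℝ}
    (hs : s ∈ Icc (0 : ℝ) 1) (ht : t ∈ Icc (0 : ℝ) 1) {x y : ℝ} (hxy : x ≤ y) :
    (callFun (μ s : Measure ℝ) y - callFun (μ t : Measure ℝ) y)
      - (callFun (μ s : Measure ℝ) x - callFun (μ t : Measure ℝ) x)
      = ∫ z in x..y, (distF μ s z - distF μ t z) := by
  have h := integral_sub_mul_sub_eq (q := fun ξ => dens μ s ξ - dens μ t ξ) hxy
    ((h₁.integrable_dens hs).sub (h₁.integrable_dens ht)).integrableOn (by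
      simp only [mul_sub]
      exact ((h₁.integrable_mul_dens hs).sub (h₁.integrable_mul_dens ht)).integrableOn)
  simp_rw [h₁.distF_sub hs ht]
  rw [h₁.callFun_sub hs ht, h₁.callFun_sub hs ht, intervalIntegral.integral_neg, ← h]
  ring

end MarginalAssumption

namespace RegularFamily

lemma integrableOn_ker (S : RegularFamily μ ε₁ mLow mUp ρ) (x : ℝ) {t : ℝ}
    (ht : t ∈ Icc (0 : ℝ) 1) : IntegrableOn (fun ξ => ker μ (t, ξ)) (Ioi x) := by
  simpa using S.integrableOn_weight_ker 1 0 x ht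

lemma integrableOn_mul_ker (S : RegularFamily μ ε₁ mLow mUp ρ) (x : ℝ) {t : ℝ}
    (ht : t ∈ Icc (0 : ℝ) 1) : IntegrableOn (fun ξ => ξ * ker μ (t, ξ)) (Ioi x) := by
  simpa using S.integrableOn_weight_ker 0 1 x ht

lemma callRate_eq (S : RegularFamily μ ε₁ mLow mUp ρ) {p : ℝ × ℝ} (hp : p.1 ∈ Icc (0 : ℝ) 1) :
    callRate μ p = tailInt μ 0 1 p - p.2 * tailInt μ 1 0 p := by
  simp only [callRate, tailInt]
  rw [← integral_const_mul, ← integral_sub (S.integrableOn_weight_ker 0 1 _ hp)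
    ((S.integrableOn_weight_ker 1 0 _ hp).const_mul _)]
  congr 1
  ext ξ
  ring

lemma continuousOn_callRate (S : RegularFamily μ ε₁ mLow mUp ρ) :
    ContinuousOn (callRate μ) (closE μ ρ) :=
  ((S.continuousOn_tailInt 0 1).sub
    (continuousOn_snd.mul (S.continuousOn_tailInt 1 0))).congr fun _ hp => S.callRate_eq hp.1

lemma callFun_sub_eq (S : RegularFamily μ ε₁ mLow mUp ρ) {t x s : ℝ}
    (hp : (t, x) ∈ closE μ ρ) (hts : t ≤ s) (hs : s ≤ 1) (hs' : s ≤ t + ε₁) :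
    callFun (μ s : Measure ℝ) x - callFun (μ t : Measure ℝ) x
      = ∫ u in t..s, callRate μ (u, x) := by
  rw [S.marg.callFun_sub ⟨hp.1.1.trans hts, hs⟩ hp.1]
  simp only [callRate]
  rw [← S.integral_weight_dens_sub (-x) 1 hp hts hs hs']
  congr 1
  ext ξ
  ring

lemma distF_sub_eq (S : RegularFamily μ ε₁ mLow mUp ρ) {t x s : ℝ}
    (hp : (t, x) ∈ closE μ ρ) (hts : t ≤ s) (hs : s ≤ 1) (hs' : s ≤ t + ε₁) :
    distF μ s x - distF μ t x = -∫ u in t..s, tailInt μ 1 0 (u, x) := by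
  rw [S.marg.distF_sub ⟨hp.1.1.trans hts, hs⟩ hp.1,
    ← S.integral_weight_dens_sub 1 0 hp hts hs hs']
  simp

lemma callRate_sub_eq (S : RegularFamily μ ε₁ mLow mUp ρ) {t x y : ℝ} (ht : t ∈ Icc (0 : ℝ) 1)
    (hxy : x ≤ y) :
    callRate μ (t, x) - callRate μ (t, y) = ∫ z in x..y, tailInt μ 1 0 (t, z) := by
  have h := integral_sub_mul_sub_eq hxy (S.integrableOn_ker x ht) (S.integrableOn_mul_ker x ht)
  have e : ∀ z, ∫ ξ in Ioi z, (ξ - z) * ker μ (t, ξ) = callRate μ (t, z) := fun z => by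
    simp only [callRate, tailInt]
    congr 1
    ext ξ
    ring
  rw [e, e] at h
  rw [h]
  simp [tailInt]

lemma tendsto_time_right (S : RegularFamily μ ε₁ mLow mUp ρ) {t x : ℝ} (ht1 : t < 1)
    (hp : (t, x) ∈ closE μ ρ) :
    Tendsto (fun s => (s, x)) (𝓝[≥] t) (𝓝[closE μ ρ] (t, x)) := by
  refine tendsto_nhdsWithin_iff.2 ⟨?_, ?_⟩
  · exact (Continuous.tendsto (by fun_prop) t).mono_left nhdsWithin_le_nhds
  · filter_upwards [Icc_mem_nhdsGE (show t < min 1 (t + ε₁) from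
      lt_min ht1 (by linarith [S.marg.eps_pos]))] with s hs
    exact S.mem_closE_of_le hp hs.1 (hs.2.trans (min_le_left _ _)) (hs.2.trans (min_le_right _ _))

lemma tendsto_time_domE (S : RegularFamily μ ε₁ mLow mUp ρ) {t x : ℝ} (hp : (t, x) ∈ domE μ) :
    Tendsto (fun s => (s, x)) (𝓝[Icc 0 1] t) (𝓝[closE μ ρ] (t, x)) := by
  refine tendsto_nhdsWithin_iff.2 ⟨?_, ?_⟩
  · exact (Continuous.tendsto (by fun_prop) t).mono_left nhdsWithin_le_nhds
  · filter_upwards [S.marg.time_mem S.right hp] with s hs using S.domE_subset_closE hs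

lemma dtF_eq (S : RegularFamily μ ε₁ mLow mUp ρ) {t x : ℝ} (hp : (t, x) ∈ domE μ) :
    dtF μ t x = -tailInt μ 1 0 (t, x) := by
  -- Gives the `FTCFilter` instance for `𝓝[Icc 0 1] t`, which covers the one-sided end times as
  -- well.
  have : Fact (t ∈ Icc (0 : ℝ) 1) := ⟨hp.1⟩
  have hc : ContinuousWithinAt (fun s => tailInt μ 1 0 (s, x)) (Icc 0 1) t :=
    (S.continuousOn_tailInt 1 0 _ (S.domE_subset_closE hp)).tendsto.comp (S.tendsto_time_domE hp)
  have hd := intervalIntegral.integral_hasDerivWithinAt_right (a := t) (b := t)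
    (f := fun s => tailInt μ 1 0 (s, x)) (s := Icc 0 1) (t := Icc 0 1) (by simp)
    (S.stronglyMeasurable_tailInt 1 0 x).stronglyMeasurableAtFilter hc
  have hd' := (hd.neg.const_add (distF μ t x)).congr_of_eventuallyEq (f₁ := fun s => distF μ s x)
    (by
      have he := S.marg.eps_pos
      filter_upwards [S.marg.time_mem S.right hp, nhdsWithin_le_nhds
        (Ioo_mem_nhds (show t - ε₁ < t by linarith) (show t < t + ε₁ by linarith))] with s hs hst
      rcases le_total t s with h | h
      · have := S.distF_sub_eq (S.domE_subset_closE hp) h hs.1.2 hst.2.le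
        simp only [Pi.neg_apply]
        linarith
      -- The increment formula runs forward in time only. For `s ≤ t` it is started at `(s, x)`,
      -- which is in `E` by relative openness.
      · have := S.distF_sub_eq (S.domE_subset_closE hs) h hp.1.2 (by linarith [hst.1])
        simp only [Pi.neg_apply]
        rw [intervalIntegral.integral_symm]
        linarith) (by simp)
  exact hd'.derivWithin (uniqueDiffOn_Icc zero_lt_one _ hp.1)

/-- The right derivative in time of the call function. -/
lemma tendsto_callFun_slope (S : RegularFamily μ ε₁ mLow mUp ρ) {t x : ℝ} (ht1 : t < 1)
    (hp : (t, x) ∈ closE μ ρ) :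
    Tendsto (fun ε => (callFun (μ (t + ε) : Measure ℝ) x - callFun (μ t : Measure ℝ) x) / ε)
      (𝓝[>] 0) (𝓝 (callRate μ (t, x))) := by
  have hc : ContinuousWithinAt (fun s => callRate μ (s, x)) (Ici t) t :=
    (S.continuousOn_callRate _ hp).tendsto.comp (S.tendsto_time_right ht1 hp)
  have hd := intervalIntegral.integral_hasDerivWithinAt_right (a := t) (b := t)
    (f := fun s => callRate μ (s, x)) (s := Ici t) (t := Ioi t) (by simp)
    (S.stronglyMeasurable_tailInt (-x) 1 x).stronglyMeasurableAtFilter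
    (hc.mono Ioi_subset_Ici_self)
  have h := (hasDerivWithinAt_iff_tendsto_slope' self_notMem_Ioi).1 (hd.mono Ioi_subset_Ici_self)
  have hm := tendsto_const_add_nhdsGT t
  refine (h.comp hm).congr' ?_
  filter_upwards [Ioo_mem_nhdsGT (show (0 : ℝ) < min ε₁ (1 - t) from
    lt_min S.marg.eps_pos (by linarith))] with ε hε
  have h2 := lt_min_iff.1 hε.2
  rw [S.callFun_sub_eq hp (by linarith [hε.1]) (by linarith) (by linarith)]
  simp [slope_def_field]

end RegularFamily
end PhaseTransition

namespace PhaseTransition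

variable {μ : ℝ → ProbabilityMeasure ℝ} {ε₁ ε₂ : ℝ} {mLow mUp : ℝ → ℝ → ℝ} {mTilde : ℝ → ℝ}
  {ρ : EReal}

/-! ### The shape of the difference of two call functions -/

namespace MarginalAssumption

lemma distF_sub_nonneg (h₁ : MarginalAssumption μ ε₁ mLow mUp) {t ε a b z : ℝ}
    (ht : t ∈ Icc (0 : ℝ) 1) (hs : t + ε ∈ Icc (0 : ℝ) 1) (hd : Dispersion μ t ε a b)
    (hz : z ≤ a) : 0 ≤ distF μ (t + ε) z - distF μ t z := by
  rw [h₁.distF_eq hs, h₁.distF_eq ht, ← integral_sub (h₁.integrable_dens hs).integrableOn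
    (h₁.integrable_dens ht).integrableOn]
  refine integral_nonneg_of_ae ?_
  filter_upwards [ae_restrict_mem measurableSet_Iic, ae_restrict_of_ae (Measure.ae_ne volume z),
    ae_restrict_of_ae (ae_ne_ereal (leftEnd (μ (t + ε) : Measure ℝ)))] with ξ hξ hne hl
  rcases lt_or_gt_of_ne hl with h | h
  · have e1 : dens μ (t + ε) ξ = 0 := deriv_cdf_eq_zero_of_lt h
    have e2 : dens μ t ξ = 0 := deriv_cdf_eq_zero_of_lt (h.trans_le hd.left_le)
    simp [e1, e2]
  · exact sub_nonneg.2 (hd.left_tail ξ h ((lt_of_le_of_ne hξ hne).trans_le hz)).le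

lemma distF_sub_nonpos (h₁ : MarginalAssumption μ ε₁ mLow mUp) {t ε a b z : ℝ}
    (ht : t ∈ Icc (0 : ℝ) 1) (hs : t + ε ∈ Icc (0 : ℝ) 1) (hd : Dispersion μ t ε a b)
    (hz : b ≤ z) : distF μ (t + ε) z - distF μ t z ≤ 0 := by
  rw [h₁.distF_sub hs ht, neg_nonpos]
  refine integral_nonneg_of_ae ?_
  filter_upwards [ae_restrict_mem measurableSet_Ioi,
    ae_restrict_of_ae (ae_ne_ereal (rightEnd (μ (t + ε) : Measure ℝ)))] with ξ hξ hl
  rcases lt_or_gt_of_ne hl with h | h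
  · exact sub_nonneg.2 (hd.right_tail ξ (lt_of_le_of_lt hz hξ) h).le
  · have e1 : dens μ (t + ε) ξ = 0 := deriv_cdf_eq_zero_of_gt h
    have e2 : dens μ t ξ = 0 := deriv_cdf_eq_zero_of_gt (hd.right_le.trans_lt h)
    simp [e1, e2]

lemma distF_sub_anti (h₁ : MarginalAssumption μ ε₁ mLow mUp) {t ε a b x y : ℝ}
    (ht : t ∈ Icc (0 : ℝ) 1) (hs : t + ε ∈ Icc (0 : ℝ) 1) (hd : Dispersion μ t ε a b)
    (hx : a ≤ x) (hxy : x ≤ y) (hy : y ≤ b) :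
    distF μ (t + ε) y - distF μ t y ≤ distF μ (t + ε) x - distF μ t x := by
  have hi := (h₁.integrable_dens hs).sub (h₁.integrable_dens ht)
  have e : ∀ z, distF μ (t + ε) z - distF μ t z
      = ∫ ξ in Iic z, (dens μ (t + ε) - dens μ t) ξ := fun z => by
    rw [h₁.distF_eq hs, h₁.distF_eq ht, ← integral_sub (h₁.integrable_dens hs).integrableOn
      (h₁.integrable_dens ht).integrableOn]
    rfl
  rw [← sub_nonpos, e, e,
    intervalIntegral.integral_Iic_sub_Iic hi.integrableOn hi.integrableOn,
    intervalIntegral.integral_of_le hxy, ← neg_nonneg, ← integral_neg]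
  refine integral_nonneg_of_ae ?_
  filter_upwards [ae_restrict_mem measurableSet_Ioc, ae_restrict_of_ae (Measure.ae_ne volume b)]
    with ξ hξ hne
  have := hd.middle ξ ⟨hx.trans_lt hξ.1, lt_of_le_of_ne (hξ.2.trans hy) hne⟩
  simp only [Pi.zero_apply, Pi.sub_apply]
  linarith

/-- The difference of the distribution functions changes sign at most once. -/
lemma distF_sub_single_crossing (h₁ : MarginalAssumption μ ε₁ mLow mUp) {t ε a b p q : ℝ}
    (ht : t ∈ Icc (0 : ℝ) 1) (hs : t + ε ∈ Icc (0 : ℝ) 1) (hd : Dispersion μ t ε a b)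
    (hp : distF μ (t + ε) p - distF μ t p < 0) (hpq : p ≤ q) :
    distF μ (t + ε) q - distF μ t q ≤ 0 := by
  have hap : a ≤ p := by
    by_contra! h
    exact not_le.2 hp (h₁.distF_sub_nonneg ht hs hd h.le)
  rcases le_total q b with h | h
  · exact (h₁.distF_sub_anti ht hs hd hap hpq h).trans hp.le
  · exact h₁.distF_sub_nonpos ht hs hd h

lemma callFun_sub_anti (h₁ : MarginalAssumption μ ε₁ mLow mUp) {s t x y : ℝ}
    (ht : t ∈ Icc (0 : ℝ) 1) (hs : s ∈ Icc (0 : ℝ) 1) (hxy : x ≤ y)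
    (h : ∀ z, x ≤ z → distF μ s z - distF μ t z ≤ 0) :
    callFun (μ s : Measure ℝ) y - callFun (μ t : Measure ℝ) y
      ≤ callFun (μ s : Measure ℝ) x - callFun (μ t : Measure ℝ) x := by
  rw [← sub_nonpos, h₁.callFun_sub_increment hs ht hxy, intervalIntegral.integral_of_le hxy]
  exact setIntegral_nonpos measurableSet_Ioc fun z hz => h z hz.1.le

lemma callFun_sub_nonneg (h₁ : MarginalAssumption μ ε₁ mLow mUp) {s t x : ℝ}
    (ht : t ∈ Icc (0 : ℝ) 1) (hs : s ∈ Icc (0 : ℝ) 1)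
    (h : ∀ z, x ≤ z → distF μ s z - distF μ t z ≤ 0) :
    0 ≤ callFun (μ s : Measure ℝ) x - callFun (μ t : Measure ℝ) x := by
  have hl := (tendsto_callFun_atTop (h₁.integrable s hs)).sub
    (tendsto_callFun_atTop (h₁.integrable t ht))
  rw [sub_zero] at hl
  refine le_of_tendsto hl ?_
  filter_upwards [eventually_ge_atTop x] with y hy
  exact h₁.callFun_sub_anti ht hs hy h

lemma exists_distF_sub_neg (h₁ : MarginalAssumption μ ε₁ mLow mUp) {s t x y : ℝ}
    (ht : t ∈ Icc (0 : ℝ) 1) (hs : s ∈ Icc (0 : ℝ) 1) (hxy : x ≤ y)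
    (h : callFun (μ s : Measure ℝ) y - callFun (μ t : Measure ℝ) y
      < callFun (μ s : Measure ℝ) x - callFun (μ t : Measure ℝ) x) :
    ∃ p ≤ y, distF μ s p - distF μ t p < 0 := by
  by_contra! hc
  rw [← sub_neg, h₁.callFun_sub_increment hs ht hxy, intervalIntegral.integral_of_le hxy] at h
  exact not_le.2 h (setIntegral_nonneg measurableSet_Ioc fun z hz => hc z hz.2)

/-- The slope of the difference in the strike is the difference of the distribution functions, which
stays nonpositive once it has been negative. After a drop there is no rise. -/
lemma callFun_sub_quasiconcave (h₁ : MarginalAssumption μ ε₁ mLow mUp) {t ε a b x y z : ℝ}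
    (ht : t ∈ Icc (0 : ℝ) 1) (hs : t + ε ∈ Icc (0 : ℝ) 1) (hd : Dispersion μ t ε a b)
    (hxy : x ≤ y) (hyz : y ≤ z) :
    min (callFun (μ (t + ε) : Measure ℝ) x - callFun (μ t : Measure ℝ) x)
      (callFun (μ (t + ε) : Measure ℝ) z - callFun (μ t : Measure ℝ) z)
      ≤ callFun (μ (t + ε) : Measure ℝ) y - callFun (μ t : Measure ℝ) y := by
  rw [min_le_iff]
  by_contra! hc
  obtain ⟨p, hpy, hp⟩ := h₁.exists_distF_sub_neg ht hs hxy hc.1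
  exact not_le.2 hc.2 (h₁.callFun_sub_anti ht hs hyz fun w hw =>
    h₁.distF_sub_single_crossing ht hs hd hp (hpy.trans hw))

/-- A fall below zero would need a negative slope somewhere; from then on the difference is
nonincreasing with limit `0` at infinity, hence nonnegative. -/
lemma callFun_sub_nonneg_of_pos (h₁ : MarginalAssumption μ ε₁ mLow mUp) {t ε a b x y : ℝ}
    (ht : t ∈ Icc (0 : ℝ) 1) (hs : t + ε ∈ Icc (0 : ℝ) 1) (hd : Dispersion μ t ε a b)
    (hxy : x ≤ y) (hx : 0 < callFun (μ (t + ε) : Measure ℝ) x - callFun (μ t : Measure ℝ) x) :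
    0 ≤ callFun (μ (t + ε) : Measure ℝ) y - callFun (μ t : Measure ℝ) y := by
  by_contra! hc
  obtain ⟨p, hpy, hp⟩ := h₁.exists_distF_sub_neg ht hs hxy (hc.trans hx)
  exact not_le.2 hc (h₁.callFun_sub_nonneg ht hs fun w hw =>
    h₁.distF_sub_single_crossing ht hs hd hp (hpy.trans hw))

end MarginalAssumption

/-! ### Zeros of `∂ₜ ∫ (ξ - x)⁺ μ_t(dξ)` -/

lemma nhdsLT_one_le : 𝓝[<] (1 : ℝ) ≤ 𝓝[Icc 0 1] 1 :=
  nhdsWithin_le_iff.2 (mem_of_superset (Ioo_mem_nhdsLT zero_lt_one) Ioo_subset_Icc_self)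

namespace RegularFamily

lemma eventually_step (S : RegularFamily μ ε₁ mLow mUp ρ) {t : ℝ} (ht : t ∈ Ico (0 : ℝ) 1) :
    ∀ᶠ ε in 𝓝[>] (0 : ℝ), 0 < ε ∧ ε ≤ ε₁ ∧ t + ε ∈ Icc (0 : ℝ) 1 ∧
      Dispersion μ t ε (mLow t ε) (mUp t ε) := by
  filter_upwards [Ioo_mem_nhdsGT (show (0 : ℝ) < min ε₁ (1 - t) from
    lt_min S.marg.eps_pos (by linarith [ht.2]))] with ε hε
  have h2 := lt_min_iff.1 hε.2
  exact ⟨hε.1, h2.1.le, ⟨by linarith [ht.1, hε.1], by linarith⟩,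
    S.marg.dispersion t ht ε hε.1 hε.2.le⟩

lemma tendsto_left_one (S : RegularFamily μ ε₁ mLow mUp ρ) {x : ℝ} (hp : (1, x) ∈ domE μ) :
    Tendsto (fun s => callRate μ (s, x)) (𝓝[<] 1) (𝓝 (callRate μ (1, x))) := by
  exact (S.continuousOn_callRate _ (S.domE_subset_closE hp)).tendsto.comp
    ((S.tendsto_time_domE hp).mono_left nhdsLT_one_le)

lemma callRate_quasiconcave_of_lt_one (S : RegularFamily μ ε₁ mLow mUp ρ) {t x y z : ℝ}
    (ht : t < 1) (hx : (t, x) ∈ closE μ ρ) (hz : (z : EReal) < ρ) (hxy : x ≤ y) (hyz : y ≤ z) :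
    min (callRate μ (t, x)) (callRate μ (t, z)) ≤ callRate μ (t, y) := by
  have mem : ∀ w, x ≤ w → w ≤ z → (t, w) ∈ closE μ ρ := fun w h1 h2 =>
    ⟨hx.1, hx.2.1.trans (EReal.coe_le_coe_iff.2 h1), lt_of_le_of_lt (EReal.coe_le_coe_iff.2 h2) hz⟩
  refine le_of_tendsto_of_tendsto
    ((S.tendsto_callFun_slope ht hx).min (S.tendsto_callFun_slope ht (mem z (hxy.trans hyz) le_rfl)))
    (S.tendsto_callFun_slope ht (mem y hxy hyz)) ?_
  filter_upwards [S.eventually_step ⟨hx.1.1, ht⟩] with ε ⟨h0, h1, hs, hd⟩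
  rw [min_div_div_right h0.le]
  exact div_le_div_of_nonneg_right (S.marg.callFun_sub_quasiconcave hx.1 hs hd hxy hyz) h0.le

lemma tendsto_space_right (S : RegularFamily μ ε₁ mLow mUp ρ) {t x : ℝ}
    (hx : (t, x) ∈ closE μ ρ) :
    (∀ᶠ y in 𝓝[>] x, (t, y) ∈ domE μ) ∧
      Tendsto (fun y => callRate μ (t, y)) (𝓝[>] x) (𝓝 (callRate μ (t, x))) := by
  obtain ⟨w, hxw, hw⟩ := EReal.lt_iff_exists_real_btwn.1 hx.2.2
  have hev : ∀ᶠ y in 𝓝[>] x, (t, y) ∈ domE μ := by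
    filter_upwards [Ioo_mem_nhdsGT (EReal.coe_lt_coe_iff.1 hxw)] with y hy
    exact S.mem_domE_of_closE hx hy.1 ((EReal.coe_lt_coe_iff.2 hy.2).trans hw)
  refine ⟨hev, (S.continuousOn_callRate _ hx).tendsto.comp (tendsto_nhdsWithin_iff.2 ⟨?_, ?_⟩)⟩
  · exact (Continuous.tendsto (by fun_prop) x).mono_left nhdsWithin_le_nhds
  · exact hev.mono fun y hy => S.domE_subset_closE hy

lemma callRate_quasiconcave (S : RegularFamily μ ε₁ mLow mUp ρ) {t x y z : ℝ}
    (hx : (t, x) ∈ closE μ ρ) (hz : (z : EReal) < ρ) (hxy : x ≤ y) (hyz : y ≤ z) :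
    min (callRate μ (t, x)) (callRate μ (t, z)) ≤ callRate μ (t, y) := by
  rcases hx.1.2.lt_or_eq with ht | ht
  · exact S.callRate_quasiconcave_of_lt_one ht hx hz hxy hyz
  simp only at ht
  subst ht
  rcases hxy.eq_or_lt with rfl | hxy
  · exact min_le_left _ _
  -- Time `1` is reached through `s ↑ 1`, which requires points of `E`; a point `x` of the left edge
  -- is therefore first approached by `w ↓ x`.
  refine le_of_tendsto ((S.tendsto_space_right hx).2.min tendsto_const_nhds) ?_
  filter_upwards [(S.tendsto_space_right hx).1, Ioo_mem_nhdsGT hxy] with w hw hwx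
  have mem : ∀ v, x < v → v ≤ z → (1, v) ∈ domE μ := fun v h1 h2 =>
    S.mem_domE_of_closE hx h1 (lt_of_le_of_lt (EReal.coe_le_coe_iff.2 h2) hz)
  refine le_of_tendsto_of_tendsto ((S.tendsto_left_one hw).min
    (S.tendsto_left_one (mem z (hxy.trans_le hyz) le_rfl))) (S.tendsto_left_one (mem y hxy hyz)) ?_
  filter_upwards [nhdsLT_one_le (S.marg.time_mem S.right hw), self_mem_nhdsWithin]
    with s hs hs1
  exact S.callRate_quasiconcave_of_lt_one hs1 (S.domE_subset_closE hs) hz hwx.2.le hyz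

lemma _root_.PhaseTransition.ExtremaAssumption.mUp_mem
    (h₂ : ExtremaAssumption μ ε₁ ε₂ mUp mTilde) {t : ℝ} (ht : t ∈ Icc (0 : ℝ) 1) : (t, mUp t 0) ∈ domE μ := by
  have : mUp t 0 ∈ ({mUp t 0} : Set ℝ) := rfl
  rw [← h₂.localMin t ht] at this
  exact ⟨ht, this.1⟩

lemma continuousOn_mUp_zero (S : RegularFamily μ ε₁ mLow mUp ρ)
    (h₂ : ExtremaAssumption μ ε₁ ε₂ mUp mTilde) :
    ContinuousOn (fun t => mUp t 0) (Icc 0 1) := by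
  refine h₂.continuous.comp (f := fun t : ℝ => (t, (0 : ℝ))) (by fun_prop) fun t ht => ?_
  exact ⟨le_rfl, (lt_min S.marg.eps_pos h₂.eps_pos).le, ht.1, by simpa using ht.2⟩

lemma tendsto_mUp (S : RegularFamily μ ε₁ mLow mUp ρ)
    (h₂ : ExtremaAssumption μ ε₁ ε₂ mUp mTilde) {t : ℝ} (ht : t ∈ Ico (0 : ℝ) 1) :
    Tendsto (fun ε => mUp t ε) (𝓝[>] 0) (𝓝 (mUp t 0)) := by
  have h0 := lt_min S.marg.eps_pos h₂.eps_pos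
  refine (h₂.continuous (t, 0) ⟨le_rfl, h0.le, ht.1, by simpa using ht.2.le⟩).tendsto.comp
    (f := fun ε : ℝ => (t, ε)) (tendsto_nhdsWithin_iff.2 ⟨?_, ?_⟩)
  · exact (Continuous.tendsto (by fun_prop) 0).mono_left nhdsWithin_le_nhds
  · filter_upwards [Ioo_mem_nhdsGT (lt_min h0 (show 0 < 1 - t by linarith [ht.2]))] with ε hε
    have h2 := lt_min_iff.1 hε.2
    exact ⟨hε.1.le, h2.1.le, ht.1, show t ≤ 1 - ε by linarith⟩

/-- Since `m^ε(t) → m_t`, a point beyond `m_t` lies beyond the upper crossing for small `ε`, where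
the call difference decreases to `0`. -/
lemma callRate_nonneg (S : RegularFamily μ ε₁ mLow mUp ρ)
    (h₂ : ExtremaAssumption μ ε₁ ε₂ mUp mTilde) {t x : ℝ} (ht : t ∈ Icc (0 : ℝ) 1)
    (hx : mUp t 0 < x) (hxρ : (x : EReal) < ρ) : 0 ≤ callRate μ (t, x) := by
  have key : ∀ s ∈ Ico (0 : ℝ) 1, mUp s 0 < x → 0 ≤ callRate μ (s, x) := fun s hs hsx => by
    have hs' := Ico_subset_Icc_self hs
    have hE := S.mem_domE_of_closE (S.domE_subset_closE (h₂.mUp_mem hs')) hsx hxρ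
    refine ge_of_tendsto (S.tendsto_callFun_slope hs.2 (S.domE_subset_closE hE)) ?_
    filter_upwards [S.eventually_step hs, (S.tendsto_mUp h₂ hs).eventually (gt_mem_nhds hsx)]
      with ε ⟨h0, h1, hse, hd⟩ hm
    refine div_nonneg (S.marg.callFun_sub_nonneg hs' hse fun z hz => ?_) h0.le
    exact S.marg.distF_sub_nonpos hs' hse hd (hm.le.trans hz)
  rcases ht.2.lt_or_eq with h | rfl
  · exact key t ⟨ht.1, h⟩ hx
  · have hE := S.mem_domE_of_closE (S.domE_subset_closE (h₂.mUp_mem ht)) hx hxρ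
    refine ge_of_tendsto (S.tendsto_left_one hE) ?_
    filter_upwards [nhdsLT_one_le ((S.continuousOn_mUp_zero h₂ 1 ht).eventually
      (gt_mem_nhds hx)), Ioo_mem_nhdsLT zero_lt_one] with s hs hs1
    exact key s ⟨hs1.1.le, hs1.2⟩ hs

/-- The time derivative of the call function vanishes on no interval. -/
lemma exists_callRate_ne_zero (S : RegularFamily μ ε₁ mLow mUp ρ)
    (h₂ : ExtremaAssumption μ ε₁ ε₂ mUp mTilde) {t a b : ℝ} (ha : (t, a) ∈ closE μ ρ)
    (hab : a < b) (hb : (b : EReal) ≤ ρ) : ∃ z ∈ Ioo a b, callRate μ (t, z) ≠ 0 := by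
  by_contra! hc
  have mem : ∀ z ∈ Ioo a b, (t, z) ∈ domE μ := fun z hz =>
    S.mem_domE_of_closE ha hz.1 (lt_of_lt_of_le (EReal.coe_lt_coe_iff.2 hz.2) hb)
  have hcont : ContinuousOn (fun z => tailInt μ 1 0 (t, z)) (Ioo a b) :=
    (S.continuousOn_tailInt 1 0).comp (by fun_prop) fun z hz => S.domE_subset_closE (mem z hz)
  have hA : ∀ z ∈ Ioo a b, tailInt μ 1 0 (t, z) = 0 := fun z hz => by
    have hca := hcont.continuousAt (isOpen_Ioo.mem_nhds hz)
    have hd := intervalIntegral.integral_hasDerivWithinAt_right (a := z) (b := z)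
      (f := fun w => tailInt μ 1 0 (t, w)) (s := Ici z) (t := Ioi z) (by simp)
      ((hcont.stronglyMeasurableAtFilter isOpen_Ioo z hz).filter_mono nhdsWithin_le_nhds)
      hca.continuousWithinAt
    have hd0 : HasDerivWithinAt (fun u => ∫ w in z..u, tailInt μ 1 0 (t, w)) 0 (Ici z) z := by
      refine (hasDerivWithinAt_const z (Ici z) (0 : ℝ)).congr_of_eventuallyEq ?_ (by simp)
      filter_upwards [Ico_mem_nhdsGE hz.2] with u hu
      rw [← S.callRate_sub_eq ha.1 hu.1, hc z hz, hc u ⟨hz.1.trans_le hu.1, hu.2⟩, sub_zero]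
    exact (uniqueDiffOn_Ici z z self_mem_Ici).eq_deriv _ hd hd0
  -- `∂ₜF` vanishes on the whole interval, so each of its points is a local minimizer; two distinct
  -- ones contradict uniqueness.
  have hmin : ∀ z ∈ Ioo a b, z = mUp t 0 := fun z hz => by
    have : z ∈ {x ∈ suppInterval (μ t : Measure ℝ) | IsLocalMin (dtF μ t) x} := by
      refine ⟨(mem z hz).2, ?_⟩
      filter_upwards [isOpen_Ioo.mem_nhds hz] with w hw
      rw [S.dtF_eq (mem z hz), S.dtF_eq (mem w hw), hA z hz, hA w hw]
    rw [h₂.localMin t ha.1] at this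
    exact this
  have e1 := hmin ((2 * a + b) / 3) ⟨by linarith, by linarith⟩
  have e2 := hmin ((a + 2 * b) / 3) ⟨by linarith, by linarith⟩
  linarith

/-- Between two zeros there is a point with positive value, and another lies beyond the larger zero
and `m_t`. Quasi-concavity then makes the larger zero positive. -/
lemma callRate_zero_unique (S : RegularFamily μ ε₁ mLow mUp ρ)
    (h₂ : ExtremaAssumption μ ε₁ ε₂ mUp mTilde) {t x z : ℝ} (hx : (t, x) ∈ closE μ ρ)
    (hz : (t, z) ∈ closE μ ρ) (hx0 : callRate μ (t, x) = 0) (hz0 : callRate μ (t, z) = 0) :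
    x = z := by
  wlog hxz : x < z generalizing x z
  · rcases (not_lt.1 hxz).eq_or_lt with h | h
    · exact h.symm
    · exact (this hz hx hz0 hx0 h).symm
  exfalso
  obtain ⟨y, hy, hy0⟩ := S.exists_callRate_ne_zero h₂ hx hxz hz.2.2.le
  have hypos : 0 < callRate μ (t, y) := by
    refine lt_of_le_of_ne ?_ hy0.symm
    have := S.callRate_quasiconcave hx hz.2.2 hy.1.le hy.2.le
    rwa [hx0, hz0, min_self] at this
  have hyE := S.domE_subset_closE
    (S.mem_domE_of_closE hx hy.1 ((EReal.coe_lt_coe_iff.2 hy.2).trans hz.2.2))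
  have hm := S.domE_subset_closE (h₂.mUp_mem hx.1)
  have hmax : (t, max z (mUp t 0)) ∈ closE μ ρ := by
    rcases max_choice z (mUp t 0) with h | h <;> rw [h]
    · exact hz
    · exact hm
  obtain ⟨b, hab, hb⟩ := EReal.lt_iff_exists_real_btwn.1 hmax.2.2
  obtain ⟨w, hw, hw0⟩ := S.exists_callRate_ne_zero h₂ hmax (EReal.coe_lt_coe_iff.1 hab) hb.le
  have hwρ : (w : EReal) < ρ := (EReal.coe_lt_coe_iff.2 hw.2).trans hb
  have hwpos := lt_of_le_of_ne
    (S.callRate_nonneg h₂ hx.1 ((le_max_right _ _).trans_lt hw.1) hwρ) hw0.symm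
  have := S.callRate_quasiconcave hyE hwρ hy.2.le ((le_max_left _ _).trans hw.1.le)
  rw [hz0] at this
  exact not_lt.2 this (lt_min hypos hwpos)

end RegularFamily
end PhaseTransition

namespace PhaseTransition

variable {μ : ℝ → ProbabilityMeasure ℝ} {ε₁ ε₂ ε₀ : ℝ} {mLow mUp : ℝ → ℝ → ℝ}
  {mTilde : ℝ → ℝ} {ρ : EReal}

/-! ### Localization of the phase transition point -/

namespace RegularFamily

lemma measure_Ioo_pos (S : RegularFamily μ ε₁ mLow mUp ρ) {t x y : ℝ} (hxy : x < y)
    (hx : (t, x) ∈ domE μ) (hy : (t, y) ∈ domE μ) : 0 < (μ t : Measure ℝ) (Ioo x y) := by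
  have h : 0 < (μ t : Measure ℝ).real (Ioo x y) := by
    rw [measureReal_eq_integral_deriv_cdf (S.marg.abs_cont t hx.1) measurableSet_Ioo,
      setIntegral_pos_iff_support_of_nonneg_ae (.of_forall fun _ => deriv_cdf_nonneg _ _)
        (S.marg.integrable_dens hx.1).integrableOn]
    have hsub : Ioo x y ⊆ Function.support (deriv (ProbabilityTheory.cdf (μ t : Measure ℝ))) ∩
        Ioo x y := fun z hz => by
      refine ⟨(S.marg.dens_pos t hx.1 z ⟨?_, ?_⟩).ne', hz⟩
      · exact hx.2.1.trans (EReal.coe_lt_coe_iff.2 hz.1)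
      · exact (EReal.coe_lt_coe_iff.2 hz.2).trans hy.2.2
    refine lt_of_lt_of_le ?_ (measure_mono hsub)
    rw [Real.volume_Ioo]
    exact ENNReal.ofReal_pos.2 (by linarith)
  exact (ENNReal.toReal_pos_iff.1 h).1

lemma tendsto_callFun_sub (S : RegularFamily μ ε₁ mLow mUp ρ) {t x : ℝ} (ht1 : t < 1)
    (hp : (t, x) ∈ closE μ ρ) :
    Tendsto (fun ε => callFun (μ (t + ε) : Measure ℝ) x - callFun (μ t : Measure ℝ) x)
      (𝓝[>] 0) (𝓝 0) := by
  have h0 : Tendsto (fun ε : ℝ => ε) (𝓝[>] 0) (𝓝 0) := nhdsWithin_le_nhds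
  have := (S.tendsto_callFun_slope ht1 hp).mul h0
  rw [mul_zero] at this
  refine this.congr' ?_
  filter_upwards [self_mem_nhdsWithin] with ε hε
  exact div_mul_cancel₀ _ (ne_of_gt hε)

/-- The rate is positive on a whole box around `(t, x)` and is integrated in time there. The point
is that one threshold for `ε` serves all strikes in `[y, x]`. -/
lemma eventually_callFun_sub_nonneg (S : RegularFamily μ ε₁ mLow mUp ρ) {t x : ℝ} (ht1 : t < 1)
    (hp : (t, x) ∈ domE μ) (hK : 0 < callRate μ (t, x)) :
    ∃ y < x, (t, y) ∈ domE μ ∧ ∀ᶠ ε in 𝓝[>] (0 : ℝ), ∀ k ∈ Icc y x,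
      0 ≤ callFun (μ (t + ε) : Measure ℝ) k - callFun (μ t : Measure ℝ) k := by
  have hev : ∀ᶠ p in 𝓝[Icc (0 : ℝ) 1 ×ˢ univ] (t, x), p ∈ domE μ ∧ 0 < callRate μ p := by
    rw [← S.marg.nhdsWithin_domE S.right hp]
    have hc := (S.continuousOn_callRate.mono S.domE_subset_closE) _ hp
    filter_upwards [self_mem_nhdsWithin, hc.eventually (lt_mem_nhds hK)] with p h1 h2
    exact ⟨h1, h2⟩
  rw [nhdsWithin_prod_eq, nhdsWithin_univ] at hev
  obtain ⟨U, hU, V, hV, hUV⟩ := mem_prod_iff.1 hev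
  obtain ⟨l, u, hx, hlu⟩ := mem_nhds_iff_exists_Ioo_subset.1 hV
  have hyx : (l + x) / 2 < x := by linarith [hx.1]
  have hsub : Icc ((l + x) / 2) x ⊆ V := fun k hk =>
    hlu ⟨by linarith [hk.1, hx.1], hk.2.trans_lt hx.2⟩
  refine ⟨(l + x) / 2, hyx, (@hUV (t, (l + x) / 2)
    ⟨mem_of_mem_nhdsWithin hp.1 hU, hsub ⟨le_rfl, hyx.le⟩⟩).1, ?_⟩
  obtain ⟨r, hr, hrU⟩ := Metric.mem_nhdsWithin_iff.1 hU
  filter_upwards [S.eventually_step ⟨hp.1.1, ht1⟩, Ioo_mem_nhdsGT hr] with ε ⟨h0, h1, hs, _⟩ hεr k hk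
  have mem : ∀ v ∈ Icc t (t + ε), (v, k) ∈ domE μ ∧ 0 < callRate μ (v, k) := fun v hv =>
    @hUV (v, k) ⟨hrU ⟨by
      rw [Metric.mem_ball, Real.dist_eq, abs_of_nonneg (by linarith [hv.1])]
      linarith [hv.2, hεr.2], hp.1.1.trans hv.1, hv.2.trans hs.2⟩, hsub hk⟩
  have htk := (mem t ⟨le_rfl, by linarith⟩).1
  rw [S.callFun_sub_eq (S.domE_subset_closE htk) (by linarith) hs.2 (by linarith)]
  exact intervalIntegral.integral_nonneg (by linarith) fun v hv => (mem v hv).2.le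

/-- Strikes above `x` are handled by single crossing, strikes in `[y, x]` by local positivity, and
strikes below `y` by convexity. -/
lemma eventually_phaseEps_le (S : RegularFamily μ ε₁ mLow mUp ρ) {t x : ℝ} (ht1 : t < 1)
    (hp : (t, x) ∈ domE μ) (hK : 0 < callRate μ (t, x)) :
    ∀ᶠ ε in 𝓝[>] (0 : ℝ), phaseEps μ t ε ≤ x := by
  have hc := S.domE_subset_closE hp
  have hi := S.marg.integrable t hp.1
  obtain ⟨y, hyx, hy, hev⟩ := S.eventually_callFun_sub_nonneg ht1 hp hK
  have hgap := callFun_sub_tangent_pos hi (S.measure_Ioo_pos hyx hy hp)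
  filter_upwards [S.eventually_step ⟨hp.1.1, ht1⟩, hev,
    (S.tendsto_callFun_slope ht1 hc).eventually (lt_mem_nhds hK),
    (S.tendsto_callFun_sub ht1 hc).eventually (gt_mem_nhds (sub_pos.2 hgap))]
    with ε ⟨h0, h1, hs, hd⟩ hnn hslope hsmall
  have hi' := S.marg.integrable _ hs
  have hDx : 0 < callFun (μ (t + ε) : Measure ℝ) x - callFun (μ t : Measure ℝ) x := by
    have := mul_pos hslope h0
    rwa [div_mul_cancel₀ _ h0.ne'] at this
  refine phasePoint_le ((shortfall_eq_zero_iff hi hi' x).2 fun k => ?_)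
  rcases le_total x k with hxk | hkx
  · have := S.marg.callFun_sub_nonneg_of_pos hp.1 hs hd hxk hDx
    linarith [callFun_restrict_le hi (Ici x) k]
  rcases le_total y k with hyk | hky
  · have := hnn k ⟨hyk, hkx⟩
    linarith [callFun_restrict_le hi (Ici x) k]
  · set c := (μ t : Measure ℝ).real (Ici x) with hcdef
    -- `C_{μ_{t+ε}}` minus the tangent of `C_{μ_t}` at `x`. At `y` it is at least the fixed gap, at
    -- `x` it is smaller than the gap, so by convexity it only grows to the left of `y`.
    have hconv : ConvexOn ℝ univ
        fun z => callFun (μ (t + ε) : Measure ℝ) z - (callFun (μ t : Measure ℝ) x + (x - z) * c) := by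
      refine ⟨convex_univ, fun z _ w _ a b ha hb hab => ?_⟩
      have := (convexOn_callFun hi').2 (mem_univ z) (mem_univ w) ha hb hab
      simp only [smul_eq_mul] at this ⊢
      have e : callFun (μ t : Measure ℝ) x + (x - (a * z + b * w)) * c
          = a * (callFun (μ t : Measure ℝ) x + (x - z) * c)
            + b * (callFun (μ t : Measure ℝ) x + (x - w) * c) := by
        have hb' : b = 1 - a := by linarith
        rw [hb']
        ring
      rw [e]
      linarith
    have e1 := callFun_restrict_Ici hi hyx.le
    have e2 := callFun_restrict_Ici hi hkx
    have hy0 := hnn y ⟨le_rfl, hyx.le⟩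
    have := hconv.le_left_of_right_le'' (mem_univ k) (mem_univ x) hky hyx
      (by simp only [sub_self, zero_mul, add_zero]; linarith)
    linarith

lemma eventually_le_phaseEps (S : RegularFamily μ ε₁ mLow mUp ρ) {t x : ℝ} (ht1 : t < 1)
    (hp : (t, x) ∈ closE μ ρ) (hK : callRate μ (t, x) < 0) :
    ∀ᶠ ε in 𝓝[>] (0 : ℝ), (x : EReal) ≤ phaseEps μ t ε := by
  filter_upwards [S.eventually_step ⟨hp.1.1, ht1⟩,
    (S.tendsto_callFun_slope ht1 hp).eventually (gt_mem_nhds hK)] with ε ⟨h0, h1, hs, hd⟩ hslope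
  refine le_phasePoint_of_callFun_lt (S.marg.integrable t hp.1) (S.marg.integrable _ hs) ?_ ?_
  · rw [S.right t hp.1]
    exact hp.2.2.le
  · have := mul_neg_of_neg_of_pos hslope h0
    rw [div_mul_cancel₀ _ h0.ne'] at this
    linarith

lemma leftEnd_le_phaseEps (S : RegularFamily μ ε₁ mLow mUp ρ)
    (h₂ : ExtremaAssumption μ ε₁ ε₂ mUp mTilde) (h₃ : TransitionAssumption μ ε₀)
    {t ε : ℝ} (h : (t, ε) ∈ stepDomain ε₀) :
    leftEnd (μ t : Measure ℝ) ≤ phaseEps μ t ε := by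
  obtain ⟨h0, h1, h2, h3⟩ := h
  simp only at h0 h1 h2 h3
  have ht : t ∈ Icc (0 : ℝ) 1 := ⟨h2, by linarith⟩
  refine leftEnd_le_phasePoint (S.marg.integrable t ht)
    (S.marg.integrable _ ⟨by linarith, by linarith⟩) ?_ fun hbot => ?_
  · have := (h₂.mUp_mem ht).2
    exact (this.1.trans this.2).le
  · obtain ⟨B, hB⟩ := h₃.bounded
    have := (hB (t, ε) ⟨h0, h1, h2, h3⟩).1
    rw [phaseEps, hbot] at this
    exact EReal.coe_ne_bot _ (le_bot_iff.1 this)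

/-- Points with positive rate exist arbitrarily close to the right of `m_t`, and each bounds the
phase points from above. This keeps the limit strictly below `ρ`. -/
lemma le_mUp_of_tendsto (S : RegularFamily μ ε₁ mLow mUp ρ)
    (h₂ : ExtremaAssumption μ ε₁ ε₂ mUp mTilde) {t x : ℝ} (ht : t ∈ Ico (0 : ℝ) 1)
    (hx : Tendsto (fun ε => phaseEps μ t ε) (𝓝[>] 0) (𝓝 (x : EReal))) : x ≤ mUp t 0 := by
  by_contra! hlt
  have hm := h₂.mUp_mem (Ico_subset_Icc_self ht)
  have hmc := S.domE_subset_closE hm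
  obtain ⟨b, hb1, hb2⟩ := EReal.lt_iff_exists_real_btwn.1
    (lt_min (EReal.coe_lt_coe_iff.2 hlt) hmc.2.2)
  obtain ⟨hbx, hbρ⟩ := lt_min_iff.1 hb2
  obtain ⟨y, hy, hy0⟩ := S.exists_callRate_ne_zero h₂ hmc (EReal.coe_lt_coe_iff.1 hb1) hbρ.le
  have hyρ := (EReal.coe_lt_coe_iff.2 hy.2).trans hbρ
  have hpos := lt_of_le_of_ne (S.callRate_nonneg h₂ hm.1 hy.1 hyρ) hy0.symm
  have := le_of_tendsto hx (S.eventually_phaseEps_le ht.2 (S.mem_domE_of_closE hmc hy.1 hyρ) hpos)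
  exact not_lt.2 this ((EReal.coe_lt_coe_iff.2 hy.2).trans hbx)

lemma callRate_nonneg_of_tendsto (S : RegularFamily μ ε₁ mLow mUp ρ) {t x : ℝ} (ht1 : t < 1)
    (hp : (t, x) ∈ closE μ ρ)
    (hx : Tendsto (fun ε => phaseEps μ t ε) (𝓝[>] 0) (𝓝 (x : EReal))) :
    0 ≤ callRate μ (t, x) := by
  by_contra! hneg
  obtain ⟨h1, h2⟩ := S.tendsto_space_right hp
  obtain ⟨y, ⟨hy1, hy2⟩, hxy⟩ := ((h1.and (h2.eventually (gt_mem_nhds hneg))).and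
    self_mem_nhdsWithin).exists
  have := ge_of_tendsto hx (S.eventually_le_phaseEps ht1 (S.domE_subset_closE hy1) hy2)
  exact not_lt.2 (EReal.coe_le_coe_iff.1 this) hxy

lemma callRate_eq_zero_of_tendsto (S : RegularFamily μ ε₁ mLow mUp ρ) {t x : ℝ} (ht1 : t < 1)
    (hp : (t, x) ∈ domE μ)
    (hx : Tendsto (fun ε => phaseEps μ t ε) (𝓝[>] 0) (𝓝 (x : EReal))) :
    callRate μ (t, x) = 0 := by
  refine le_antisymm ?_ (S.callRate_nonneg_of_tendsto ht1 (S.domE_subset_closE hp) hx)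
  by_contra! hpos
  have hopen : IsOpen (suppInterval (μ t : Measure ℝ)) :=
    isOpen_Ioo.preimage continuous_coe_real_ereal
  have h1 : ∀ᶠ y in 𝓝 x, (t, y) ∈ domE μ := by
    filter_upwards [hopen.mem_nhds hp.2] with y hy using ⟨hp.1, hy⟩
  have h2 : Tendsto (fun y => callRate μ (t, y)) (𝓝 x) (𝓝 (callRate μ (t, x))) := by
    refine ((S.continuousOn_callRate.mono S.domE_subset_closE) _ hp).tendsto.comp
      (tendsto_nhdsWithin_iff.2 ⟨?_, h1⟩)
    exact Continuous.tendsto (by fun_prop) x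
  obtain ⟨y, ⟨hy1, hy2⟩, hxy⟩ := (((h1.and (h2.eventually (lt_mem_nhds hpos))).filter_mono
    (nhdsWithin_le_nhds (s := Iio x))).and self_mem_nhdsWithin).exists
  have := le_of_tendsto hx (S.eventually_phaseEps_le ht1 hy1 hy2)
  exact not_lt.2 (EReal.coe_le_coe_iff.1 this) hxy

/-! ### Phase transition at the left end of the support -/

lemma exists_abs_distF_sub_le (S : RegularFamily μ ε₁ mLow mUp ρ) (x : ℝ) :
    ∃ M : ℝ, 0 ≤ M ∧ ∀ t s, (t, x) ∈ closE μ ρ → t ≤ s → s ≤ 1 → s ≤ t + ε₁ →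
      |distF μ s x - distF μ t x| ≤ M * (s - t) := by
  obtain ⟨M, hM0, hM⟩ := S.exists_lintegral_le 1 0 x
  refine ⟨M, hM0, fun t s hp hts hs hs' => ?_⟩
  rw [S.distF_sub_eq hp hts hs hs', abs_neg, ← abs_of_nonneg (sub_nonneg.2 hts)]
  refine intervalIntegral.norm_integral_le_of_norm_le_const
    (f := fun u => tailInt μ 1 0 (u, x)) fun u hu => ?_
  rw [uIoc_of_le hts] at hu
  refine (norm_integral_le_lintegral_norm (fun ξ => (1 + 0 * ξ) * ker μ (u, ξ))).trans
    (ENNReal.toReal_le_of_le_ofReal hM0 ?_)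
  exact hM u ⟨hp.1.1.trans hu.1.le, hu.2.trans hs⟩

/-- A call is mean minus strike plus a put. Means decrease in time, the put at time `t` is
nonnegative, and the put at time `s` is at most `(x - y) F(s, x)` since `μ_s` has no mass below `y`.
-/
lemma callFun_sub_le (S : RegularFamily μ ε₁ mLow mUp ρ) {t s x y : ℝ}
    (ht : t ∈ Icc (0 : ℝ) 1) (hs : s ∈ Icc (0 : ℝ) 1) (hts : t ≤ s)
    (hy : (y : EReal) ≤ leftEnd (μ s : Measure ℝ)) :
    callFun (μ s : Measure ℝ) x - callFun (μ t : Measure ℝ) x ≤ (x - y) * distF μ s x := by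
  have hi := S.marg.integrable t ht
  have hi' := S.marg.integrable s hs
  have hmean : ∫ ξ, ξ ∂(μ s : Measure ℝ) ≤ ∫ ξ, ξ ∂(μ t : Measure ℝ) := by
    have := S.marg.order t ht s hs hts (fun ξ => -ξ) (by
      refine ⟨convex_univ, fun a _ b _ c d _ _ _ => le_of_eq ?_⟩
      simp only [smul_eq_mul]
      ring) (fun a b hab => neg_le_neg hab) hi.neg hi'.neg
    rw [integral_neg, integral_neg] at this
    linarith
  have h1 : (∫ ξ, ξ ∂(μ t : Measure ℝ)) - x ≤ callFun (μ t : Measure ℝ) x := by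
    have e : (∫ ξ, ξ ∂(μ t : Measure ℝ)) - x = ∫ ξ, (ξ - x) ∂(μ t : Measure ℝ) := by
      rw [integral_sub hi (integrable_const x)]
      simp
    rw [e]
    exact integral_mono (integrable_sub_const hi x) (integrable_call hi x)
      fun ξ => le_max_left _ _
  have h2 : callFun (μ s : Measure ℝ) x
      ≤ (∫ ξ, ξ ∂(μ s : Measure ℝ)) - x + (x - y) * distF μ s x := by
    have hind : Integrable (indicator (Iic x) fun _ => x - y) (μ s : Measure ℝ) :=
      (integrable_const (x - y)).indicator measurableSet_Iic
    have e : (∫ ξ, ξ ∂(μ s : Measure ℝ)) - x + (x - y) * distF μ s x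
        = ∫ ξ, ((ξ - x) + indicator (Iic x) (fun _ => x - y) ξ) ∂(μ s : Measure ℝ) := by
      rw [integral_add (integrable_sub_const hi' x) hind, integral_sub hi' (integrable_const x),
        integral_indicator measurableSet_Iic, setIntegral_const, distF,
        ProbabilityTheory.cdf_eq_real]
      simp [mul_comm]
    rw [e]
    refine integral_mono_ae (integrable_call hi' x) ((integrable_sub_const hi' x).add hind) ?_
    have hae : ∀ᵐ ξ ∂(μ s : Measure ℝ), y ≤ ξ := by
      have := measure_Iio_eq_zero hy
      rw [ae_iff]
      simp only [not_le]
      exact this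
    filter_upwards [hae] with ξ hξ
    by_cases h : ξ ≤ x
    · rw [max_eq_right (by linarith), indicator_of_mem (show ξ ∈ Iic x from h)]
      linarith
    · rw [max_eq_left (by linarith), indicator_of_notMem (show ξ ∉ Iic x from h), add_zero]
  linarith

/-- As `F(t, ℓ_t) = 0`, the value `F(t + ε, ℓ_t)` is `O(ε)`, while `ℓ_t - ℓ_{t+ε}` tends to `0`; so
the call increment at `ℓ_t` is at most `o(ε)`. -/
lemma callRate_nonpos_of_leftEnd (S : RegularFamily μ ε₁ mLow mUp ρ) {t : ℝ} (ht1 : t < 1)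
    {ℓ : ℝ → ℝ} (hp : (t, ℓ t) ∈ closE μ ρ) (hℓ : Tendsto ℓ (𝓝[>] t) (𝓝 (ℓ t)))
    (ht : leftEnd (μ t : Measure ℝ) = (ℓ t : EReal))
    (hev : ∀ᶠ s in 𝓝[>] t, leftEnd (μ s : Measure ℝ) = (ℓ s : EReal)) :
    callRate μ (t, ℓ t) ≤ 0 := by
  have hm := tendsto_const_add_nhdsGT t
  obtain ⟨M, hM0, hM⟩ := S.exists_abs_distF_sub_le (ℓ t)
  have hlim : Tendsto (fun ε => (ℓ t - ℓ (t + ε)) * M) (𝓝[>] 0) (𝓝 0) := by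
    have := ((tendsto_const_nhds (x := ℓ t)).sub (hℓ.comp hm)).mul_const M
    simpa using this
  refine le_of_tendsto_of_tendsto (S.tendsto_callFun_slope ht1 hp) hlim ?_
  filter_upwards [S.eventually_step ⟨hp.1.1, ht1⟩, hm.eventually hev] with ε ⟨h0, h1, hs, hd⟩ hε
  have hle : ℓ (t + ε) ≤ ℓ t := by
    have := hd.left_le
    rw [hε, ht] at this
    exact EReal.coe_le_coe_iff.1 this
  have hF0 : distF μ t (ℓ t) = 0 := by
    have h0 := measure_Iio_eq_zero ht.ge
    have hz : (μ t : Measure ℝ) {ℓ t} = 0 := S.marg.abs_cont t hp.1 (by simp)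
    rw [distF, ProbabilityTheory.cdf_eq_real, measureReal_def, ← Iio_union_right,
      measure_union_null h0 hz, ENNReal.toReal_zero]
  have hF := le_of_abs_le (hM t (t + ε) hp (by linarith) hs.2 (by linarith))
  rw [hF0, sub_zero, add_sub_cancel_left] at hF
  have hD := S.callFun_sub_le hp.1 hs (by linarith) hε.ge (x := ℓ t)
  rw [div_le_iff₀ h0, mul_assoc]
  exact hD.trans (mul_le_mul_of_nonneg_left hF (by linarith))

end RegularFamily

/-! ### The limit -/

lemma exists_tendsto_of_uniformContinuousOn {α : Type*} [UniformSpace α] {A : Set α} {f : α → ℝ}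
    (hf : UniformContinuousOn f A) {x : α} (hx : x ∈ closure A) :
    ∃ y, Tendsto f (𝓝[A] x) (𝓝 y) := by
  have : NeBot (𝓝[A] x) := mem_closure_iff_nhdsWithin_neBot.1 hx
  refine cauchy_map_iff_exists_tendsto.1 (cauchy_map_iff.2 ⟨this, ?_⟩)
  refine Tendsto.mono_left hf (le_inf ?_ ?_)
  · exact (cauchy_nhds.mono nhdsWithin_le_nhds).2
  · exact le_principal_iff.2 (prod_mem_prod self_mem_nhdsWithin self_mem_nhdsWithin)

lemma mem_closure_stepDomain (h0 : 0 < ε₀) {t : ℝ} (ht : t ∈ Icc (0 : ℝ) 1) :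
    (t, (0 : ℝ)) ∈ closure (stepDomain ε₀) := by
  -- The factor `1 - ε` keeps the path in the domain for `t = 1` too.
  have h : Tendsto (fun ε : ℝ => ((1 - ε) * t, ε)) (𝓝[>] 0) (𝓝 (t, 0)) := by
    have : Tendsto (fun ε : ℝ => ((1 - ε) * t, ε)) (𝓝 0) (𝓝 ((1 - 0) * t, 0)) :=
      Continuous.tendsto (by fun_prop) 0
    rw [sub_zero, one_mul] at this
    exact this.mono_left nhdsWithin_le_nhds
  refine mem_closure_of_tendsto h ?_
  filter_upwards [Ioo_mem_nhdsGT (lt_min h0 one_pos)] with ε hε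
  have h2 := lt_min_iff.1 hε.2
  refine ⟨hε.1, h2.1.le, mul_nonneg (by linarith) ht.1, ?_⟩
  exact mul_le_of_le_one_right (by linarith) ht.2

/-- The continuous limit of `x_1^ε(t)` as `ε ↓ 0`. -/
lemma TransitionAssumption.exists_limit (h₃ : TransitionAssumption μ ε₀) (h0 : 0 < ε₀) :
    ∃ x₁ : ℝ → ℝ, ContinuousOn x₁ (Icc 0 1) ∧ ∀ t ∈ Ico (0 : ℝ) 1,
      Tendsto (fun ε : ℝ => phaseEps μ t ε) (𝓝[>] 0) (𝓝 (x₁ t : EReal)) := by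
  set X : ℝ × ℝ → ℝ := fun p => (phaseEps μ p.1 p.2).toReal with hX
  have hlim : ∀ p ∈ Icc (0 : ℝ) 1 ×ˢ {(0 : ℝ)}, ∃ y, Tendsto X (𝓝[stepDomain ε₀] p) (𝓝 y) := by
    rintro ⟨t, e⟩ ⟨ht, he⟩
    obtain rfl : e = 0 := he
    exact exists_tendsto_of_uniformContinuousOn h₃.uniformContinuous (mem_closure_stepDomain h0 ht)
  have hcont : ContinuousOn (extendFrom (stepDomain ε₀) X) (Icc (0 : ℝ) 1 ×ˢ {(0 : ℝ)}) := by
    refine continuousOn_extendFrom ?_ hlim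
    rintro ⟨t, e⟩ ⟨ht, he⟩
    obtain rfl : e = 0 := he
    exact mem_closure_stepDomain h0 ht
  refine ⟨fun t => extendFrom (stepDomain ε₀) X (t, 0),
    hcont.comp (by fun_prop) fun t ht => ⟨ht, rfl⟩, fun t ht => ?_⟩
  have h1 := tendsto_extendFrom (hlim (t, 0) ⟨Ico_subset_Icc_self ht, rfl⟩)
  have hev : ∀ᶠ ε in 𝓝[>] (0 : ℝ), (t, ε) ∈ stepDomain ε₀ := by
    filter_upwards [Ioo_mem_nhdsGT (lt_min h0 (show 0 < 1 - t by linarith [ht.2]))] with ε hε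
    have h2 := lt_min_iff.1 hε.2
    exact ⟨hε.1, h2.1.le, ht.1, show t ≤ 1 - ε by linarith⟩
  have h2 : Tendsto (fun ε : ℝ => (t, ε)) (𝓝[>] 0) (𝓝[stepDomain ε₀] (t, 0)) :=
    tendsto_nhdsWithin_iff.2
      ⟨(Continuous.tendsto (by fun_prop) 0).mono_left nhdsWithin_le_nhds, hev⟩
  refine ((continuous_coe_real_ereal.tendsto _).comp (h1.comp h2)).congr' ?_
  obtain ⟨B, hB⟩ := h₃.bounded
  filter_upwards [hev] with ε hε
  obtain ⟨hl, hu⟩ := hB _ hε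
  refine EReal.coe_toReal (fun h => ?_) fun h => ?_
  · simp only at hu
    rw [h] at hu
    exact EReal.coe_ne_top _ (top_le_iff.1 hu)
  · simp only at hl
    rw [h] at hl
    exact EReal.coe_ne_bot _ (le_bot_iff.1 hl)

/-! ### The limit as a zero of the time derivative of the call function -/

namespace RegularFamily

lemma mem_closE_limit (S : RegularFamily μ ε₁ mLow mUp ρ)
    (h₂ : ExtremaAssumption μ ε₁ ε₂ mUp mTilde) (h₃ : TransitionAssumption μ (min ε₁ ε₂))
    {x₁ : ℝ → ℝ} (hc : ContinuousOn x₁ (Icc 0 1)) (hlim : ∀ t ∈ Ico (0 : ℝ) 1,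
      Tendsto (fun ε : ℝ => phaseEps μ t ε) (𝓝[>] 0) (𝓝 (x₁ t : EReal)))
    {t : ℝ} (ht : t ∈ Icc (0 : ℝ) 1) : (t, x₁ t) ∈ closE μ ρ := by
  have h0 := lt_min S.marg.eps_pos h₂.eps_pos
  have key : ∀ s ∈ Ico (0 : ℝ) 1, leftEnd (μ s : Measure ℝ) ≤ (x₁ s : EReal) := fun s hs => by
    refine ge_of_tendsto (hlim s hs) ?_
    filter_upwards [Ioo_mem_nhdsGT (lt_min h0 (show 0 < 1 - s by linarith [hs.2]))] with ε hε
    have h2 := lt_min_iff.1 hε.2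
    exact S.leftEnd_le_phaseEps h₂ h₃ ⟨hε.1, h2.1.le, hs.1, show s ≤ 1 - ε by linarith⟩
  have hup : x₁ t ≤ mUp t 0 ∧ leftEnd (μ t : Measure ℝ) ≤ (x₁ t : EReal) := by
    rcases ht.2.lt_or_eq with h | rfl
    · exact ⟨S.le_mUp_of_tendsto h₂ ⟨ht.1, h⟩ (hlim t ⟨ht.1, h⟩), key t ⟨ht.1, h⟩⟩
    · have hx := (hc 1 ht).tendsto.mono_left nhdsLT_one_le
      constructor
      · refine le_of_tendsto_of_tendsto hx
          ((S.continuousOn_mUp_zero h₂ 1 ht).tendsto.mono_left nhdsLT_one_le) ?_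
        filter_upwards [Ioo_mem_nhdsLT zero_lt_one] with s hs
        exact S.le_mUp_of_tendsto h₂ ⟨hs.1.le, hs.2⟩ (hlim s ⟨hs.1.le, hs.2⟩)
      · refine ge_of_tendsto ((continuous_coe_real_ereal.tendsto _).comp hx) ?_
        filter_upwards [Ioo_mem_nhdsLT (show max 0 (1 - ε₁) < 1 from
          max_lt one_pos (by linarith [S.marg.eps_pos]))] with s hs
        obtain ⟨hs0, hs1⟩ := max_lt_iff.1 hs.1
        exact (S.marg.leftEnd_anti hs0.le le_rfl hs.2.le (by linarith)).trans
          (key s ⟨hs0.le, hs.2⟩)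
  exact ⟨ht, hup.2, lt_of_le_of_lt (EReal.coe_le_coe_iff.2 hup.1)
    (S.domE_subset_closE (h₂.mUp_mem ht)).2.2⟩

lemma continuousOn_callRate_limit (S : RegularFamily μ ε₁ mLow mUp ρ)
    (h₂ : ExtremaAssumption μ ε₁ ε₂ mUp mTilde) (h₃ : TransitionAssumption μ (min ε₁ ε₂))
    {x₁ : ℝ → ℝ} (hc : ContinuousOn x₁ (Icc 0 1)) (hlim : ∀ t ∈ Ico (0 : ℝ) 1,
      Tendsto (fun ε : ℝ => phaseEps μ t ε) (𝓝[>] 0) (𝓝 (x₁ t : EReal))) :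
    ContinuousOn (fun t => callRate μ (t, x₁ t)) (Icc 0 1) :=
  S.continuousOn_callRate.comp (continuousOn_id.prodMk hc) fun _ ht =>
    S.mem_closE_limit h₂ h₃ hc hlim ht

lemma callRate_limit_eq_zero_of_lt_one (S : RegularFamily μ ε₁ mLow mUp ρ)
    (h₂ : ExtremaAssumption μ ε₁ ε₂ mUp mTilde) (h₃ : TransitionAssumption μ (min ε₁ ε₂))
    {x₁ : ℝ → ℝ} (hc : ContinuousOn x₁ (Icc 0 1)) (hlim : ∀ t ∈ Ico (0 : ℝ) 1,
      Tendsto (fun ε : ℝ => phaseEps μ t ε) (𝓝[>] 0) (𝓝 (x₁ t : EReal)))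
    {t : ℝ} (ht : t ∈ Ico (0 : ℝ) 1) : callRate μ (t, x₁ t) = 0 := by
  have mem := fun s hs => S.mem_closE_limit h₂ h₃ hc hlim (t := s) (Ico_subset_Icc_self hs)
  have inner : ∀ s ∈ Ico (0 : ℝ) 1, leftEnd (μ s : Measure ℝ) < (x₁ s : EReal) →
      callRate μ (s, x₁ s) = 0 := fun s hs hl =>
    S.callRate_eq_zero_of_tendsto hs.2
      (S.mem_domE (Ico_subset_Icc_self hs) hl (mem s hs).2.2) (hlim s hs)
  rcases (mem t ht).2.1.lt_or_eq with hl | hl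
  · exact inner t ht hl
  refine le_antisymm ?_ (S.callRate_nonneg_of_tendsto ht.2 (mem t ht) (hlim t ht))
  have hright : 𝓝[>] t ≤ 𝓝[Icc 0 1] t :=
    nhdsWithin_le_iff.2 (mem_of_superset (Ioo_mem_nhdsGT ht.2) fun s hs =>
      ⟨ht.1.trans hs.1.le, hs.2.le⟩)
  have ht' := Ico_subset_Icc_self ht
  -- Either the limit is interior at times arbitrarily close after `t`, where the rate is zero and
  -- continuity applies, or `x₁` coincides with the left end just after `t`, which makes the left
  -- end continuous from the right.
  by_cases hfreq : ∃ᶠ s in 𝓝[>] t, leftEnd (μ s : Measure ℝ) < (x₁ s : EReal)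
  · refine le_of_tendsto_of_frequently
      ((S.continuousOn_callRate_limit h₂ h₃ hc hlim t ht').tendsto.mono_left hright) ?_
    refine (hfreq.and_eventually (Ioo_mem_nhdsGT ht.2)).mono fun s hs => ?_
    exact (inner s ⟨ht.1.trans hs.2.1.le, hs.2.2⟩ hs.1).le
  · refine S.callRate_nonpos_of_leftEnd ht.2 (mem t ht) ((hc t ht').tendsto.mono_left hright) hl ?_
    filter_upwards [not_frequently.1 hfreq, Ioo_mem_nhdsGT ht.2] with s hs hs'
    exact le_antisymm (mem s ⟨ht.1.trans hs'.1.le, hs'.2⟩).2.1 (not_lt.1 hs)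

lemma callRate_limit_eq_zero (S : RegularFamily μ ε₁ mLow mUp ρ)
    (h₂ : ExtremaAssumption μ ε₁ ε₂ mUp mTilde) (h₃ : TransitionAssumption μ (min ε₁ ε₂))
    {x₁ : ℝ → ℝ} (hc : ContinuousOn x₁ (Icc 0 1)) (hlim : ∀ t ∈ Ico (0 : ℝ) 1,
      Tendsto (fun ε : ℝ => phaseEps μ t ε) (𝓝[>] 0) (𝓝 (x₁ t : EReal)))
    {t : ℝ} (ht : t ∈ Icc (0 : ℝ) 1) : callRate μ (t, x₁ t) = 0 := by
  rcases ht.2.lt_or_eq with h | rfl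
  · exact S.callRate_limit_eq_zero_of_lt_one h₂ h₃ hc hlim ⟨ht.1, h⟩
  · refine tendsto_nhds_unique
      ((S.continuousOn_callRate_limit h₂ h₃ hc hlim 1 ht).tendsto.mono_left nhdsLT_one_le)
      (tendsto_const_nhds.congr' ?_)
    filter_upwards [Ioo_mem_nhdsLT zero_lt_one] with s hs
    exact (S.callRate_limit_eq_zero_of_lt_one h₂ h₃ hc hlim ⟨hs.1.le, hs.2⟩).symm

lemma integrableOn_mul_dtDens (S : RegularFamily μ ε₁ mLow mUp ρ) {t x : ℝ}
    (hp : (t, x) ∈ closE μ ρ) :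
    IntegrableOn (fun ξ => (x - ξ) * dtDens μ t ξ) (Ioi x) ∧
      ∫ ξ in Ioi x, (x - ξ) * dtDens μ t ξ = -callRate μ (t, x) := by
  have hae : (fun ξ => -((-x + 1 * ξ) * ker μ (t, ξ))) =ᵐ[volume.restrict (Ioi x)]
      fun ξ => (x - ξ) * dtDens μ t ξ := by
    filter_upwards [ae_restrict_mem measurableSet_Ioi, ae_restrict_of_ae (S.dtDens_eq_ker hp)]
      with ξ hξ h
    rw [h hξ]
    ring
  refine ⟨(S.integrableOn_weight_ker (-x) 1 x hp.1).neg.congr hae, ?_⟩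
  rw [← integral_congr_ae hae, integral_neg]
  rfl

end RegularFamily

end PhaseTransition

theorem mainTheorem8 (μ : ℝ → ProbabilityMeasure ℝ) (ε₁ ε₂ : ℝ) (mLow mUp : ℝ → ℝ → ℝ)
    (mTilde : ℝ → ℝ)
    (h₁ : PhaseTransition.MarginalAssumption μ ε₁ mLow mUp)
    (h₂ : PhaseTransition.ExtremaAssumption μ ε₁ ε₂ mUp mTilde)
    (h₃ : PhaseTransition.TransitionAssumption μ (min ε₁ ε₂))
    (htail : PhaseTransition.UniformTail μ) :
    ∃ x₁ : ℝ → ℝ,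
      ContinuousOn x₁ (Icc 0 1) ∧
      (∀ t ∈ Ico (0 : ℝ) 1,
        Tendsto (fun ε : ℝ => PhaseTransition.phaseEps μ t ε) (𝓝[>] 0) (𝓝 (x₁ t : EReal))) ∧
      ∀ t ∈ Icc (0 : ℝ) 1,
        (PhaseTransition.leftEnd (μ t : Measure ℝ) ≤ (x₁ t : EReal) ∧
          (x₁ t : EReal) < PhaseTransition.rightEnd (μ t : Measure ℝ)) ∧
        ∀ x : ℝ, PhaseTransition.leftEnd (μ t : Measure ℝ) ≤ (x : EReal) →
          (x : EReal) < PhaseTransition.rightEnd (μ t : Measure ℝ) →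
          IntegrableOn (fun ξ => (x - ξ) * PhaseTransition.dtDens μ t ξ) (Ioi x) ∧
          (∫ ξ in Ioi x, (x - ξ) * PhaseTransition.dtDens μ t ξ = 0 ↔ x = x₁ t) := by
  obtain ⟨ρ, hρ⟩ := h₃.right_const
  have S : PhaseTransition.RegularFamily μ ε₁ mLow mUp ρ := ⟨h₁, hρ, htail⟩
  obtain ⟨x₁, hc, hlim⟩ := h₃.exists_limit (lt_min h₁.eps_pos h₂.eps_pos)
  refine ⟨x₁, hc, hlim, fun t ht => ?_⟩
  have hmem := S.mem_closE_limit h₂ h₃ hc hlim ht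
  refine ⟨⟨hmem.2.1, by rw [hρ t ht]; exact hmem.2.2⟩, fun x hl hr => ?_⟩
  have hx : (t, x) ∈ PhaseTransition.closE μ ρ := ⟨ht, hl, by rwa [hρ t ht] at hr⟩
  obtain ⟨hi, he⟩ := S.integrableOn_mul_dtDens hx
  have hzero := S.callRate_limit_eq_zero h₂ h₃ hc hlim ht
  refine ⟨hi, ?_⟩
  rw [he, neg_eq_zero]
  exact ⟨fun h => S.callRate_zero_unique h₂ hx hmem h hzero, fun h => h ▸ hzero⟩
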